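/- Identify $\mathbb R^2$ with $\mathbb C$. For $\ell>0$ let $\Omega_\ell=\mathbb R\times(-\ell/2,\ell/2)$, and for $y_0\in(-\ell/2,\ell/2)$ let $$T(iy_0):=\inf\left\{\int_{\mathbb R^2}|\nabla u|^2\,dx \;:\; u\in H^1_{\rm loc}(\mathbb R^2;\mathbb C),\ u(z)=\frac{2}{\bar z+iy_0}\ \text{for a.e. } z\in\mathbb C\setminus\Omega_\ell\right\}.$$ Let $\Phi(x)=\left(-\frac{2x}{1+|x|^2},\frac{1-|x|^2}{1+|x|^2}\right)$ for $x\in\mathbb R^2$, write $m=(m',m_3)$ with $m'\in\mathbb R^2$ for $m\in\mathbb R^3$, let $$\widetilde{\mathcal A}_0=\{R_0\in SO(3):R_0e_3=e_3\}\times(0,\infty)\times(-\ell/2,\ell/2),$$ and for $(R_0,r_0,y_0)\in\widetilde{\mathcal A}_0$ let $$\mathcal E_0(R_0,r_0,y_0)=r_0^2\,T(iy_0)-2r_0\int_{\mathbb R^2}(R_0\Phi)'\cdot\nabla\Phi_3\,dx .$$ **Proposition.** Let $\ell>0$. For every $y_0\in(-\ell/2,\ell/2)$ the infimum $T(iy_0)$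 is attained, and (up to equality almost everywhere) only by the map $$u_{y_0}(z)=\begin{cases}\frac{\pi}{\ell}\tanh\left(\frac{\pi}{2\ell}(z+iy_0)\right)-\frac{\pi}{\ell}\coth\left(\frac{\pi}{2\ell}(\bar z+iy_0)\right)+\frac{2}{\bar z+iy_0}&\text{if } z\in\Omega_\ell,\\[4pt] \frac{2}{\bar z+iy_0}&\text{if } z\in\mathbb C\setminus\Omega_\ell\end{cases}$$ (extended continuously to the removable singularity $z=iy_0$). Its energy is $$T(iy_0)=\frac{4\pi^3}{\ell^2\cos^2\left(\frac{\pi y_0}{\ell}\right)},$$ which is minimized over $(-\ell/2,\ell/2)$ by $y_0=0$, with $T(0)=\frac{4\pi^3}{\ell^2}$. The corresponding rescaled skyrmion radius $r_0:=\frac{4\pi}{T(0)}$ equals $\frac{\ell^2}{\pi^2}$. The triple $\left(\mathrm{id},\frac{\ell^2}{\pi^2},0\right)$ minimizes $\mathcal E_0$ over $\widetilde{\mathcal A}_0$, and the limiting energy is $$\mathcal E_0\left(\mathrm{id},\tfrac{\ell^2}{\pi^2},0\right)=-\frac{4\ell^2}{\pi}.$$ -/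

import Mathlib

open MeasureTheory
open scoped ENNReal ContDiff Matrix ComplexConjugate

noncomputable section

namespace Skyrmion

/-- `u` is locally square integrable on the plane `ℂ ≅ ℝ²`. -/
def LocallyL2 (u : ℂ → ℂ) : Prop :=
  ∀ K : Set ℂ, IsCompact K → MemLp u 2 (volume.restrict K)

/-- `(gx, gy)` is the weak (distributional) gradient of `u` on the whole plane, and
`u`, `gx`, `gy` are locally square integrable. In particular `u ∈ H¹_loc(ℝ²; ℂ)`. -/
structure HasWeakGradient (u gx gy : ℂ → ℂ) : Prop where
  fun_l2 : LocallyL2 u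
  gx_l2 : LocallyL2 gx
  gy_l2 : LocallyL2 gy
  weak_x : ∀ φ : ℂ → ℝ, ContDiff ℝ ∞ φ → HasCompactSupport φ →
    ∫ z, fderiv ℝ φ z 1 • u z = - ∫ z, φ z • gx z
  weak_y : ∀ φ : ℂ → ℝ, ContDiff ℝ ∞ φ → HasCompactSupport φ →
    ∫ z, fderiv ℝ φ z Complex.I • u z = - ∫ z, φ z • gy z

/-- The Dirichlet energy `∫_{ℝ²} |∇u|² dx`, with values in `[0, ∞]`. The weak gradient is unique
almost everywhere, so the infimum runs over a single value, and it is `∞` (the infimum of the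
empty set) if `u` is not in `H¹_loc`. -/
def dirichletEnergy (u : ℂ → ℂ) : ℝ≥0∞ :=
  ⨅ (gx : ℂ → ℂ) (gy : ℂ → ℂ) (_ : HasWeakGradient u gx gy),
    ∫⁻ z, (‖gx z‖ₑ ^ 2 + ‖gy z‖ₑ ^ 2)

/-- The competitors in the problem defining `T(a)` for the domain `Ω`: functions
`u ∈ H¹_loc(ℝ²; ℂ)` with `u(z) = 2 / (conj z - conj a)`, which is the vector
`2 (z - a) / |z - a|²`, (almost everywhere) in `ℂ ∖ Ω`. -/
def tailCompetitors (Ω : Set ℂ) (a : ℂ) : Set (ℂ → ℂ) :=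
  {u | (∃ gx gy : ℂ → ℂ, HasWeakGradient u gx gy) ∧
    ∀ᵐ z : ℂ, z ∉ Ω → u z = 2 / (conj z - conj a)}

/-- `T(a)`: the infimum of the Dirichlet energy over the competitors. -/
def tailEnergy (Ω : Set ℂ) (a : ℂ) : ℝ≥0∞ :=
  ⨅ u ∈ tailCompetitors Ω a, dirichletEnergy u

/-- `u` is the map achieving `T(a)`: it is a competitor, its energy is `T(a)`, and it is the only
such map up to equality almost everywhere. -/
def IsTailMinimizer (Ω : Set ℂ) (a : ℂ) (u : ℂ → ℂ) : Prop :=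
  u ∈ tailCompetitors Ω a ∧ dirichletEnergy u = tailEnergy Ω a ∧
    ∀ v ∈ tailCompetitors Ω a, dirichletEnergy v = tailEnergy Ω a → v =ᵐ[volume] u

/-- The strip `ℝ × (-ℓ/2, ℓ/2)`. -/
def strip (ℓ : ℝ) : Set ℂ := {z | z.im ∈ Set.Ioo (-(ℓ / 2)) (ℓ / 2)}

/-- The complex hyperbolic cotangent. -/
def coth (w : ℂ) : ℂ := Complex.cosh w / Complex.sinh w

open Classical in
/-- The explicit map `u_{y₀}` for the strip. At the removable singularity `z = i y₀` the last two
terms in the first case are `0` by the convention `x / 0 = 0`; this is also the limit of their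
sum there. -/
def stripMap (ℓ y₀ : ℝ) (z : ℂ) : ℂ :=
  if z ∈ strip ℓ then
    (Real.pi / ℓ : ℂ) * Complex.tanh (Real.pi / (2 * ℓ) * (z + Complex.I * y₀))
      - (Real.pi / ℓ : ℂ) * coth (Real.pi / (2 * ℓ) * (conj z + Complex.I * y₀))
      + 2 / (conj z + Complex.I * y₀)
  else 2 / (conj z + Complex.I * y₀)

/-- The standard Belavin-Polyakov profile
`Φ(x) = (-2 x / (1 + |x|²), (1 - |x|²) / (1 + |x|²))`. -/
def bpProfile (z : ℂ) : Fin 3 → ℝ :=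
  ![-(2 * z.re) / (1 + ‖z‖ ^ 2), -(2 * z.im) / (1 + ‖z‖ ^ 2), (1 - ‖z‖ ^ 2) / (1 + ‖z‖ ^ 2)]

/-- `∫_{ℝ²} (R Φ)' · ∇Φ₃ dx`, where `m' = (m₁, m₂)` denotes the first two components of `m`. -/
def dmiIntegral (R : Matrix.specialOrthogonalGroup (Fin 3) ℝ) : ℝ :=
  ∫ z : ℂ, ((R.1 *ᵥ bpProfile z) 0 * fderiv ℝ (fun w => bpProfile w 2) z 1
    + (R.1 *ᵥ bpProfile z) 1 * fderiv ℝ (fun w => bpProfile w 2) z Complex.I)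

/-- The limit set for the strip: triples `(R₀, r₀, y₀)` with `R₀ ∈ SO(3)`, `R₀ e₃ = e₃`,
`r₀ > 0` and `y₀ ∈ (-ℓ/2, ℓ/2)`. -/
def limitSet (ℓ : ℝ) : Set (Matrix.specialOrthogonalGroup (Fin 3) ℝ × ℝ × ℝ) :=
  {p | p.1.1 *ᵥ ![0, 0, 1] = ![0, 0, 1] ∧ 0 < p.2.1 ∧ p.2.2 ∈ Set.Ioo (-(ℓ / 2)) (ℓ / 2)}

/-- The limit energy `E₀(R₀, r₀, y₀) = r₀² T(i y₀) - 2 r₀ ∫_{ℝ²} (R₀ Φ)' · ∇Φ₃ dx` for the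
strip. -/
def limitEnergy (ℓ : ℝ) (p : Matrix.specialOrthogonalGroup (Fin 3) ℝ × ℝ × ℝ) : ℝ :=
  p.2.1 ^ 2 * (tailEnergy (strip ℓ) (Complex.I * p.2.2)).toReal - 2 * p.2.1 * dmiIntegral p.1

/-- The rescaled skyrmion radius `r₀ = 4π / T(a)` of a skyrmion centred at `a`. -/
def skyrmionRadius (Ω : Set ℂ) (a : ℂ) : ℝ := 4 * Real.pi / (tailEnergy Ω a).toReal

end Skyrmion

end

/-!
# The energy of the optimal tail in a strip

Write `∂`, `∂̄` for the Wirtinger derivatives. The proposed map `u` is glued along the boundary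
lines of the strip from the prescribed tail `h = 2 / (conj z + i y₀)`, which is antiholomorphic,
and an inner formula `U = f(z) + g(conj z)`, where `f` is the `tanh` term and `g` is the tail
minus the `coth` term. The difference `U - h` is `cos (π y / ℓ)` times a regular factor
(`hol_add_anti`), so the pieces match on the boundary and `u` has the expected weak gradient
(`hasWeakGradient_extremal`). Moreover `U` is harmonic in a neighbourhood of the closed strip.

*Minimality and uniqueness.* If `v` is a competitor, then `w = v - u` vanishes off the strip, and
`∫ ∇u · ∇w = 0`: in the strip `∇U` is the rotated gradient of the harmonic conjugate `V = -i f + i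
g`, and mixed second derivatives of a test function commute, so that testing with `χ(x / R) V`
leaves only the error `∫ χ'(x / R) / R V ∂_y w`. It tends to zero because `V` is bounded and `1 /
(1 + |x|)` is square integrable on the strip (`integral_extremal_inner_eq_zero`). Hence `E(v) =
E(u) + E(w)` (`lintegral_grad_competitor`), and `E(w) = 0` forces `w = 0`, since `w` is then
constant along vertical lines and vanishes far up (`HasWeakGradient.ae_eq_zero_of_grad_eq_zero`).

*The energy.* One has `E(u) = 2 ∫ |∂u|² + 2 ∫ |∂̄u|²`. The Jacobian `|∂u|² - |∂̄u|²` is a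
divergence, the normal component of the flux is continuous across the boundary lines and the flux
decays at infinity, so the integral vanishes (`integral_sq_dHol_eq`) and `E(u) = 4 ∫ |∂u|² = 4
∫_strip |f'|²`. The last integral is the area of `f(strip)`, as `f` is injective there. Now `tanh
w = (ζ - 1) / (ζ + 1)` with `ζ = exp (2 w)`, which turns a horizontal strip of width `π / 2` into
a half plane and then into a disc (`tanh_image`); its radius here is `π / (ℓ cos (π y₀ / ℓ))`.

*The limit energy.* A rotation about the third axis cannot increase the integrand of the
Dzyaloshinskii-Moriya term (`dmiIntegral_le`), whose integral for the identity is `4π`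
(`dmiIntegral_one`). It remains to minimize a quadratic polynomial in `r₀`.
-/

noncomputable section

namespace Skyrmion
open Filter Topology Set

/-! ### Integrals of derivatives along coordinate lines -/

theorem integral_eq_zero_of_hasDerivAt_off_countable {f f' : ℝ → ℂ} {s : Set ℝ}
    (hs : s.Countable) (hc : Continuous f) (hd : ∀ t ∉ s, HasDerivAt f (f' t) t)
    (hi : Integrable f') (hb : Tendsto f atBot (𝓝 0)) (ht : Tendsto f atTop (𝓝 0)) :
    ∫ t, f' t = 0 := by
  have h1 : Tendsto (fun r : ℝ => ∫ t in (-r)..r, f' t) atTop (𝓝 (∫ t, f' t)) :=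
    intervalIntegral_tendsto_integral hi tendsto_neg_atTop_atBot tendsto_id
  have h2 : (fun r : ℝ => ∫ t in (-r)..r, f' t) = fun r => f r - f (-r) := by
    ext r
    exact integral_eq_of_hasDerivAt_off_countable f f' hs hc.continuousOn
      (fun t ht => hd t ht.2) hi.intervalIntegrable
  rw [h2] at h1
  have h3 : Tendsto (fun r : ℝ => f r - f (-r)) atTop (𝓝 (0 - 0)) :=
    ht.sub (hb.comp tendsto_neg_atTop_atBot)
  rw [sub_zero] at h3
  exact tendsto_nhds_unique h1 h3

theorem tendsto_mk_re_cocompact (y : ℝ) {l : Filter ℝ} (hl : l ≤ cocompact ℝ) :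
    Tendsto (fun x : ℝ => (⟨x, y⟩ : ℂ)) l (cocompact ℂ) := by
  apply Tendsto.mono_left _ hl
  apply (Topology.IsClosedEmbedding.tendsto_cocompact (X := ℝ) (Y := ℂ))
  exact Function.LeftInverse.isClosedEmbedding (f := Complex.re)
    (fun x => rfl) Complex.continuous_re
    (Complex.equivRealProdCLM.symm.continuous.comp (by fun_prop : Continuous fun x : ℝ => (x, y)))

theorem tendsto_mk_im_cocompact (x : ℝ) {l : Filter ℝ} (hl : l ≤ cocompact ℝ) :
    Tendsto (fun y : ℝ => (⟨x, y⟩ : ℂ)) l (cocompact ℂ) := by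
  apply Tendsto.mono_left _ hl
  apply (Topology.IsClosedEmbedding.tendsto_cocompact (X := ℝ) (Y := ℂ))
  exact Function.LeftInverse.isClosedEmbedding (f := Complex.im)
    (fun x => rfl) Complex.continuous_im
    (Complex.equivRealProdCLM.symm.continuous.comp (by fun_prop : Continuous fun y : ℝ => (x, y)))

theorem integrable_mk {F : ℂ → ℂ} (hF : Integrable F) :
    Integrable (fun p : ℝ × ℝ => F ⟨p.1, p.2⟩) (volume.prod volume) :=
  (Complex.volume_preserving_equiv_real_prod.symm.integrable_comp_emb
    (MeasurableEquiv.measurableEmbedding _)).2 hF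

theorem integral_mk (F : ℂ → ℂ) :
    ∫ p : ℝ × ℝ, F ⟨p.1, p.2⟩ ∂(volume.prod volume) = ∫ z, F z :=
  Complex.volume_preserving_equiv_real_prod.symm.integral_comp
    (MeasurableEquiv.measurableEmbedding _) F

/-- The integral of a `y`-derivative vanishes, even if the derivative fails to exist on countably
many horizontal lines, provided that the function is continuous across them. -/
theorem integral_eq_zero_of_hasDerivAt_im {F F' : ℂ → ℂ} {s : Set ℝ} (hs : s.Countable)
    (hi : Integrable F') (hc : Continuous F)
    (hd : ∀ z : ℂ, z.im ∉ s → HasDerivAt (fun y : ℝ => F ⟨z.re, y⟩) (F' z) z.im)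
    (h0 : Tendsto F (cocompact ℂ) (𝓝 0)) : ∫ z, F' z = 0 := by
  have hm := integrable_mk hi
  rw [← integral_mk, integral_prod _ hm]
  apply integral_eq_zero_of_ae
  filter_upwards [hm.prod_right_ae] with x hx
  refine integral_eq_zero_of_hasDerivAt_off_countable (f := fun y : ℝ => F ⟨x, y⟩) hs ?_
    (fun y hy => hd ⟨x, y⟩ hy) hx ?_ ?_
  · exact hc.comp (Complex.equivRealProdCLM.symm.continuous.comp
      (by fun_prop : Continuous fun y : ℝ => (x, y)))
  · exact h0.comp (tendsto_mk_im_cocompact x atBot_le_cocompact)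
  · exact h0.comp (tendsto_mk_im_cocompact x atTop_le_cocompact)

/-- The integral of an `x`-derivative vanishes. No continuity across the exceptional horizontal
lines is needed, since almost every line in the `x`-direction avoids them. -/
theorem integral_eq_zero_of_hasDerivAt_re {F F' : ℂ → ℂ} {s : Set ℝ} (hs : s.Countable)
    (hi : Integrable F')
    (hd : ∀ z : ℂ, z.im ∉ s → HasDerivAt (fun x : ℝ => F ⟨x, z.im⟩) (F' z) z.re)
    (h0 : Tendsto F (cocompact ℂ) (𝓝 0)) : ∫ z, F' z = 0 := by
  have hm := integrable_mk hi
  rw [← integral_mk, integral_prod_symm _ hm]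
  apply integral_eq_zero_of_ae
  filter_upwards [hm.prod_left_ae, measure_eq_zero_iff_ae_notMem.1 (hs.measure_zero volume)]
    with y hy hys
  have hd' : ∀ x : ℝ, HasDerivAt (fun x : ℝ => F ⟨x, y⟩) (F' ⟨x, y⟩) x :=
    fun x => hd ⟨x, y⟩ hys
  refine integral_eq_zero_of_hasDerivAt_off_countable (f := fun x : ℝ => F ⟨x, y⟩) countable_empty
    (continuous_iff_continuousAt.2 fun x => (hd' x).continuousAt)
    (fun x _ => hd' x) hy ?_ ?_
  · exact h0.comp (tendsto_mk_re_cocompact y atBot_le_cocompact)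
  · exact h0.comp (tendsto_mk_re_cocompact y atTop_le_cocompact)

/-! ### Weak gradients -/

theorem locallyL2_of_bounded {g : ℂ → ℂ} (hg : Measurable g) {C : ℝ} (hC : ∀ z, ‖g z‖ ≤ C) :
    LocallyL2 g := by
  intro K hK
  have : IsFiniteMeasure (volume.restrict K) := ⟨by simpa using hK.measure_lt_top⟩
  exact MemLp.of_bound hg.aestronglyMeasurable C (Eventually.of_forall hC)

theorem LocallyL2.locallyIntegrable {g : ℂ → ℂ} (hg : LocallyL2 g) : LocallyIntegrable g := by
  rw [locallyIntegrable_iff]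
  intro K hK
  have : IsFiniteMeasure (volume.restrict K) := ⟨by simpa using hK.measure_lt_top⟩
  exact (hg K hK).integrable (by norm_num)

theorem LocallyL2.sub {f g : ℂ → ℂ} (hf : LocallyL2 f) (hg : LocallyL2 g) :
    LocallyL2 (fun z => f z - g z) := fun K hK => (hf K hK).sub (hg K hK)

theorem LocallyL2.integrable_smul {g : ℂ → ℂ} (hg : LocallyL2 g) {φ : ℂ → ℝ}
    (hφ : Continuous φ) (hc : HasCompactSupport φ) : Integrable (fun z => φ z • g z) :=
  hg.locallyIntegrable.integrable_smul_left_of_hasCompactSupport hφ hc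

theorem hasDerivAt_mk_re (z : ℂ) : HasDerivAt (fun x : ℝ => (⟨x, z.im⟩ : ℂ)) 1 z.re := by
  have : (fun x : ℝ => (⟨x, z.im⟩ : ℂ)) = fun x : ℝ => (x : ℂ) + z.im * Complex.I := by
    ext x; simp [Complex.ext_iff]
  rw [this]
  exact (Complex.ofRealCLM.hasDerivAt).add_const _

theorem hasDerivAt_mk_im (z : ℂ) :
    HasDerivAt (fun y : ℝ => (⟨z.re, y⟩ : ℂ)) Complex.I z.im := by
  have : (fun y : ℝ => (⟨z.re, y⟩ : ℂ)) = fun y : ℝ => (z.re : ℂ) + y * Complex.I := by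
    ext x; simp [Complex.ext_iff]
  rw [this]
  simpa using ((Complex.ofRealCLM.hasDerivAt (x := z.im)).mul_const Complex.I).const_add (z.re : ℂ)

theorem continuous_fderiv_apply {φ : ℂ → ℝ} (hφ : ContDiff ℝ ∞ φ) (v : ℂ) :
    Continuous (fun z => fderiv ℝ φ z v) :=
  (hφ.continuous_fderiv (by simp)).clm_apply continuous_const

theorem hasCompactSupport_fderiv_apply {φ : ℂ → ℝ} (hφ : HasCompactSupport φ) (v : ℂ) :
    HasCompactSupport (fun z => fderiv ℝ φ z v) :=
  hφ.fderiv_apply (𝕜 := ℝ) v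

/-- A continuous function with bounded partial derivatives off countably many horizontal lines has
these as weak gradient. -/
theorem hasWeakGradient_of_hasDerivAt {u gx gy : ℂ → ℂ} {s : Set ℝ} (hs : s.Countable)
    (hu : Continuous u) (hx : Measurable gx) (hy : Measurable gy) {C : ℝ}
    (hxC : ∀ z, ‖gx z‖ ≤ C) (hyC : ∀ z, ‖gy z‖ ≤ C)
    (hdx : ∀ z : ℂ, z.im ∉ s → HasDerivAt (fun x : ℝ => u ⟨x, z.im⟩) (gx z) z.re)
    (hdy : ∀ z : ℂ, z.im ∉ s → HasDerivAt (fun y : ℝ => u ⟨z.re, y⟩) (gy z) z.im) :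
    HasWeakGradient u gx gy := by
  have hul : LocallyL2 u := fun K hK => by
    obtain ⟨M, hM⟩ := hK.exists_bound_of_continuousOn hu.continuousOn
    have : IsFiniteMeasure (volume.restrict K) := ⟨by simpa using hK.measure_lt_top⟩
    exact MemLp.of_bound hu.aestronglyMeasurable M
      ((ae_restrict_iff' hK.measurableSet).2 (Eventually.of_forall hM))
  have hgx := locallyL2_of_bounded hx hxC
  have hgy := locallyL2_of_bounded hy hyC
  refine ⟨hul, hgx, hgy, fun φ hφ hc => ?_, fun φ hφ hc => ?_⟩
  · have i1 := hul.integrable_smul (continuous_fderiv_apply hφ 1)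
      (hasCompactSupport_fderiv_apply hc 1)
    have i2 := hgx.integrable_smul hφ.continuous hc
    rw [eq_neg_iff_add_eq_zero, ← integral_add i1 i2]
    refine integral_eq_zero_of_hasDerivAt_re (F := fun z => φ z • u z) hs (i1.add i2)
      (fun z hz => ?_) (HasCompactSupport.is_zero_at_infty (hc.smul_right (f' := u)))
    have := ((hφ.differentiable (by simp) z).hasFDerivAt.comp_hasDerivAt z.re
      (hasDerivAt_mk_re z)).smul (hdx z hz)
    rw [add_comm]
    exact this
  · have i1 := hul.integrable_smul (continuous_fderiv_apply hφ Complex.I)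
      (hasCompactSupport_fderiv_apply hc Complex.I)
    have i2 := hgy.integrable_smul hφ.continuous hc
    rw [eq_neg_iff_add_eq_zero, ← integral_add i1 i2]
    refine integral_eq_zero_of_hasDerivAt_im (F := fun z => φ z • u z) hs (i1.add i2)
      (hφ.continuous.smul hu) (fun z hz => ?_)
      (HasCompactSupport.is_zero_at_infty (hc.smul_right (f' := u)))
    have := ((hφ.differentiable (by simp) z).hasFDerivAt.comp_hasDerivAt z.im
      (hasDerivAt_mk_im z)).smul (hdy z hz)
    rw [add_comm]
    exact this

theorem HasWeakGradient.sub {u gx gy v hx hy : ℂ → ℂ} (hu : HasWeakGradient u gx gy)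
    (hv : HasWeakGradient v hx hy) :
    HasWeakGradient (fun z => u z - v z) (fun z => gx z - hx z) (fun z => gy z - hy z) := by
  refine ⟨hu.fun_l2.sub hv.fun_l2, hu.gx_l2.sub hv.gx_l2, hu.gy_l2.sub hv.gy_l2,
    fun φ hφ hc => ?_, fun φ hφ hc => ?_⟩
  · have c1 := continuous_fderiv_apply hφ 1
    have c2 := hasCompactSupport_fderiv_apply hc 1
    simp only [smul_sub]
    rw [integral_sub (hu.fun_l2.integrable_smul c1 c2) (hv.fun_l2.integrable_smul c1 c2),
      integral_sub (hu.gx_l2.integrable_smul hφ.continuous hc)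
        (hv.gx_l2.integrable_smul hφ.continuous hc), hu.weak_x φ hφ hc, hv.weak_x φ hφ hc]
    ring
  · have c1 := continuous_fderiv_apply hφ Complex.I
    have c2 := hasCompactSupport_fderiv_apply hc Complex.I
    simp only [smul_sub]
    rw [integral_sub (hu.fun_l2.integrable_smul c1 c2) (hv.fun_l2.integrable_smul c1 c2),
      integral_sub (hu.gy_l2.integrable_smul hφ.continuous hc)
        (hv.gy_l2.integrable_smul hφ.continuous hc), hu.weak_y φ hφ hc, hv.weak_y φ hφ hc]
    ring

theorem HasWeakGradient.congr {u v gx gy : ℂ → ℂ} (hu : HasWeakGradient u gx gy)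
    (h : v =ᵐ[volume] u) : HasWeakGradient v gx gy := by
  refine ⟨fun K hK => (hu.fun_l2 K hK).ae_eq (ae_restrict_of_ae h.symm), hu.gx_l2, hu.gy_l2,
    fun φ hφ hc => ?_, fun φ hφ hc => ?_⟩
  · rw [← hu.weak_x φ hφ hc]
    exact integral_congr_ae (h.mono fun z hz => by simp only [hz])
  · rw [← hu.weak_y φ hφ hc]
    exact integral_congr_ae (h.mono fun z hz => by simp only [hz])

/-- Weak gradients are local. -/
theorem HasWeakGradient.ae_eq_zero_of_ae_eq_zero {u gx gy : ℂ → ℂ} (hu : HasWeakGradient u gx gy)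
    {U : Set ℂ} (hU : IsOpen U) (h : ∀ᵐ z : ℂ, z ∈ U → u z = 0) :
    (∀ᵐ z : ℂ, z ∈ U → gx z = 0) ∧ ∀ᵐ z : ℂ, z ∈ U → gy z = 0 := by
  have key : ∀ (φ : ℂ → ℝ) (v : ℂ), tsupport φ ⊆ U → ∫ z, fderiv ℝ φ z v • u z = 0 := by
    intro φ v hφ
    apply integral_eq_zero_of_ae
    filter_upwards [h] with z hz
    by_cases hzU : z ∈ U
    · simp [hz hzU]
    · have : fderiv ℝ φ z = 0 := by
        have h1 : z ∉ tsupport (fderiv ℝ φ) := fun h2 => hzU (hφ (tsupport_fderiv_subset ℝ h2))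
        exact image_eq_zero_of_notMem_tsupport h1
      simp [this]
  constructor
  · refine hU.ae_eq_zero_of_integral_contDiff_smul_eq_zero
      (hu.gx_l2.locallyIntegrable.locallyIntegrableOn U) fun φ hφ hc ht => ?_
    rw [← neg_eq_zero, ← hu.weak_x φ hφ hc, key φ 1 ht]
  · refine hU.ae_eq_zero_of_integral_contDiff_smul_eq_zero
      (hu.gy_l2.locallyIntegrable.locallyIntegrableOn U) fun φ hφ hc ht => ?_
    rw [← neg_eq_zero, ← hu.weak_y φ hφ hc, key φ Complex.I ht]

theorem HasWeakGradient.ae_eq {u gx gy hx hy : ℂ → ℂ} (h : HasWeakGradient u gx gy)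
    (h' : HasWeakGradient u hx hy) : gx =ᵐ[volume] hx ∧ gy =ᵐ[volume] hy := by
  have := (h.sub h').ae_eq_zero_of_ae_eq_zero isOpen_univ (by simp)
  constructor
  · filter_upwards [this.1] with z hz using sub_eq_zero.1 (hz trivial)
  · filter_upwards [this.2] with z hz using sub_eq_zero.1 (hz trivial)

/-- The weak form of `∂_y φ ∂_x u - ∂_x φ ∂_y u` being a divergence. -/
theorem HasWeakGradient.integral_fderiv_smul_comm {u gx gy : ℂ → ℂ} (hu : HasWeakGradient u gx gy)
    {φ : ℂ → ℝ} (hφ : ContDiff ℝ ∞ φ) (hc : HasCompactSupport φ) :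
    ∫ z, fderiv ℝ φ z Complex.I • gx z = ∫ z, fderiv ℝ φ z 1 • gy z := by
  have hd : ∀ v : ℂ, ContDiff ℝ ∞ (fun z => fderiv ℝ φ z v) := fun v =>
    (hφ.fderiv_right (m := ∞) (by simp)).clm_apply contDiff_const
  have h1 := hu.weak_x _ (hd Complex.I) (hasCompactSupport_fderiv_apply hc _)
  have h2 := hu.weak_y _ (hd 1) (hasCompactSupport_fderiv_apply hc _)
  rw [← neg_inj, ← h1, ← h2]
  congr 1 with z
  have hdd : DifferentiableAt ℝ (fderiv ℝ φ) z :=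
    (hφ.fderiv_right (m := ∞) (by simp)).differentiable (by simp) z
  rw [fderiv_clm_apply hdd (by fun_prop), fderiv_clm_apply hdd (by fun_prop)]
  have hs : IsSymmSndFDerivAt ℝ φ z := hφ.contDiffAt.isSymmSndFDerivAt (by
    simpa using (WithTop.coe_le_coe.2 le_top : ((2 : ℕ∞) : WithTop ℕ∞) ≤ ((⊤ : ℕ∞) : WithTop ℕ∞)))
  simp [hs.eq 1 Complex.I]

/-- A function with `∂_y u = 0` that vanishes in an upper half plane is zero: the convolutions with
test functions are constant along vertical lines and vanish far up. -/
theorem HasWeakGradient.ae_eq_zero_of_grad_eq_zero {u gx gy : ℂ → ℂ}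
    (hu : HasWeakGradient u gx gy) (hy : gy =ᵐ[volume] 0) {M : ℝ}
    (h : ∀ᵐ z : ℂ, M ≤ z.im → u z = 0) : u =ᵐ[volume] 0 := by
  refine ae_eq_zero_of_integral_contDiff_smul_eq_zero hu.fun_l2.locallyIntegrable
    fun ψ hψ hc => ?_
  have hg : ContDiff ℝ ∞ (fun z => ψ (-z)) := hψ.comp contDiff_neg
  have hgc : HasCompactSupport (fun z => ψ (-z)) := hc.comp_homeomorph (Homeomorph.neg ℂ)
  -- `W 0` is the integral of `ψ • u`, because convolution reflects its second argument.
  set g : ℂ → ℝ := fun z => ψ (-z) with hgdef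
  set L : ℂ →L[ℝ] ℝ →L[ℝ] ℂ := (ContinuousLinearMap.lsmul ℝ ℝ).flip with hL
  set W : ℂ → ℂ := convolution u g L volume with hW
  have hul := hu.fun_l2.locallyIntegrable
  have hWd : ∀ z, HasFDerivAt W (convolution u (fderiv ℝ g) (L.precompR ℂ) volume z) z :=
    fun z => hgc.hasFDerivAt_convolution_right L hul (hg.of_le (by simp)) z
  have hWI : ∀ z, fderiv ℝ W z Complex.I = 0 := by
    intro z
    rw [(hWd z).fderiv, convolution_def, ContinuousLinearMap.integral_apply
      ((hgc.fderiv ℝ).convolutionExists_right (L.precompR ℂ) hul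
        (hg.continuous_fderiv (by simp)) z)]
    have hφ : ContDiff ℝ ∞ (fun t => g (z - t)) := hg.comp (contDiff_const.sub contDiff_id)
    have hφc : HasCompactSupport (fun t => g (z - t)) :=
      hgc.comp_homeomorph (Homeomorph.subLeft z)
    have h1 := hu.weak_y _ hφ hφc
    have h2 : ∫ t, g (z - t) • gy t = 0 :=
      integral_eq_zero_of_ae (hy.mono fun t ht => by simp [ht])
    rw [h2, neg_zero, ← neg_eq_zero, ← integral_neg] at h1
    rw [← h1]
    congr 1 with t
    have : fderiv ℝ (fun t => g (z - t)) t = -fderiv ℝ g (z - t) := by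
      have h4 := (hg.differentiable (by simp) (z - t)).hasFDerivAt.comp t
        ((hasFDerivAt_id (𝕜 := ℝ) t).const_sub z)
      refine h4.fderiv.trans ?_
      ext v
      simp
    simp [this, hL]
  have hconst : ∀ t : ℝ, W (0 + t * Complex.I) = W 0 := by
    have hd : ∀ t : ℝ, HasDerivAt (fun y : ℝ => W (0 + y * Complex.I)) 0 t := fun t => by
      have hmk : HasDerivAt (fun y : ℝ => (0 : ℂ) + y * Complex.I) Complex.I t := by
        simpa using ((Complex.ofRealCLM.hasDerivAt (x := t)).mul_const Complex.I).const_add (0 : ℂ)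
      have h := (hWd (0 + t * Complex.I)).comp_hasDerivAt t hmk
      rw [← (hWd _).fderiv, hWI] at h
      exact h
    intro t
    have := is_const_of_deriv_eq_zero (fun t => (hd t).differentiableAt)
      (fun t => (hd t).deriv) t 0
    simpa using this
  obtain ⟨r, hr⟩ := hc.isCompact.isBounded.subset_closedBall 0
  have hzero : W (0 + ((M + r : ℝ) : ℂ) * Complex.I) = 0 := by
    rw [hW, convolution_def]
    apply integral_eq_zero_of_ae
    filter_upwards [h] with t ht
    by_cases hM : M ≤ t.im
    · simp [ht hM]
    · have : g (0 + ((M + r : ℝ) : ℂ) * Complex.I - t) = 0 := by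
        apply image_eq_zero_of_notMem_tsupport (f := ψ)
        intro h2
        have h3 := hr h2
        rw [mem_closedBall_zero_iff] at h3
        have h4 := (Complex.abs_im_le_norm _).trans h3
        rw [abs_le] at h4
        simp at h4
        linarith
      rw [this]; simp
  rw [hconst] at hzero
  rw [← hzero, hW, convolution_def]
  simp [hL, hgdef]

/-! ### Bounds for hyperbolic functions -/

theorem sinh_re_im (w : ℂ) : Complex.sinh w =
    ⟨Real.sinh w.re * Real.cos w.im, Real.cosh w.re * Real.sin w.im⟩ := by
  conv_lhs => rw [← Complex.re_add_im w]
  rw [Complex.sinh_add, Complex.sinh_mul_I, Complex.cosh_mul_I, ← Complex.ofReal_sinh,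
    ← Complex.ofReal_cosh, ← Complex.ofReal_sin, ← Complex.ofReal_cos]
  apply Complex.ext <;> simp only [Complex.add_re, Complex.add_im, Complex.mul_re, Complex.mul_im,
    Complex.ofReal_re, Complex.ofReal_im, Complex.I_re, Complex.I_im] <;> ring

theorem cosh_re_im (w : ℂ) : Complex.cosh w =
    ⟨Real.cosh w.re * Real.cos w.im, Real.sinh w.re * Real.sin w.im⟩ := by
  conv_lhs => rw [← Complex.re_add_im w]
  rw [Complex.cosh_add, Complex.sinh_mul_I, Complex.cosh_mul_I, ← Complex.ofReal_sinh,
    ← Complex.ofReal_cosh, ← Complex.ofReal_sin, ← Complex.ofReal_cos]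
  apply Complex.ext <;> simp only [Complex.add_re, Complex.add_im, Complex.mul_re, Complex.mul_im,
    Complex.ofReal_re, Complex.ofReal_im, Complex.I_re, Complex.I_im] <;> ring

theorem abs_le_abs_sinh (a : ℝ) : |a| ≤ |Real.sinh a| := by
  rw [Real.abs_sinh]; exact Real.self_le_sinh_iff.2 (abs_nonneg a)

theorem norm_sq_sinh (w : ℂ) :
    ‖Complex.sinh w‖ ^ 2 = Real.sinh w.re ^ 2 + Real.sin w.im ^ 2 := by
  rw [Complex.sq_norm, Complex.normSq_apply, sinh_re_im]
  have h1 := Real.cosh_sq w.re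
  have h2 := Real.sin_sq_add_cos_sq w.im
  simp only
  linear_combination Real.sin w.im ^ 2 * h1 + Real.sinh w.re ^ 2 * h2

theorem norm_sq_cosh (w : ℂ) :
    ‖Complex.cosh w‖ ^ 2 = Real.sinh w.re ^ 2 + Real.cos w.im ^ 2 := by
  rw [Complex.sq_norm, Complex.normSq_apply, cosh_re_im]
  have h1 := Real.cosh_sq w.re
  have h2 := Real.sin_sq_add_cos_sq w.im
  simp only
  linear_combination Real.cos w.im ^ 2 * h1 + Real.sinh w.re ^ 2 * h2

theorem abs_sinh_le_norm_sinh (w : ℂ) : |Real.sinh w.re| ≤ ‖Complex.sinh w‖ :=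
  abs_le_of_sq_le_sq (by rw [norm_sq_sinh]; exact le_add_of_nonneg_right (sq_nonneg _))
    (norm_nonneg _)

theorem abs_sinh_le_norm_cosh (w : ℂ) : |Real.sinh w.re| ≤ ‖Complex.cosh w‖ :=
  abs_le_of_sq_le_sq (by rw [norm_sq_cosh]; exact le_add_of_nonneg_right (sq_nonneg _))
    (norm_nonneg _)

theorem abs_re_le_norm_sinh (w : ℂ) : |w.re| ≤ ‖Complex.sinh w‖ :=
  (abs_le_abs_sinh _).trans (abs_sinh_le_norm_sinh w)

theorem abs_re_le_norm_cosh (w : ℂ) : |w.re| ≤ ‖Complex.cosh w‖ :=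
  (abs_le_abs_sinh _).trans (abs_sinh_le_norm_cosh w)

theorem norm_sinh_le (w : ℂ) : ‖Complex.sinh w‖ ≤ 1 + |Real.sinh w.re| := by
  refine (pow_le_pow_iff_left₀ (norm_nonneg _) (by positivity) two_ne_zero).1 ?_
  rw [norm_sq_sinh, add_sq, sq_abs]
  nlinarith [Real.sin_sq_le_one w.im, abs_nonneg (Real.sinh w.re)]

theorem norm_cosh_le (w : ℂ) : ‖Complex.cosh w‖ ≤ 1 + |Real.sinh w.re| := by
  refine (pow_le_pow_iff_left₀ (norm_nonneg _) (by positivity) two_ne_zero).1 ?_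
  rw [norm_sq_cosh, add_sq, sq_abs]
  nlinarith [Real.cos_sq_le_one w.im, abs_nonneg (Real.sinh w.re)]

theorem norm_sinh_div_cosh_le {w : ℂ} {δ : ℝ} (hδ : 0 < δ) (h : δ ≤ |w.re|) :
    ‖Complex.sinh w / Complex.cosh w‖ ≤ 1 / δ + 1 := by
  have h1 := h.trans (abs_le_abs_sinh _)
  have h2 := abs_sinh_le_norm_cosh w
  rw [norm_div, div_le_iff₀ (by linarith)]
  calc ‖Complex.sinh w‖ ≤ 1 + |Real.sinh w.re| := norm_sinh_le w
    _ ≤ (1 / δ + 1) * |Real.sinh w.re| := by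
      rw [add_mul, one_mul, div_mul_eq_mul_div, one_mul]
      gcongr
      rwa [one_le_div hδ]
    _ ≤ _ := by gcongr

theorem norm_cosh_div_sinh_le {w : ℂ} {δ : ℝ} (hδ : 0 < δ) (h : δ ≤ |w.re|) :
    ‖Complex.cosh w / Complex.sinh w‖ ≤ 1 / δ + 1 := by
  have h1 := h.trans (abs_le_abs_sinh _)
  have h2 := abs_sinh_le_norm_sinh w
  rw [norm_div, div_le_iff₀ (by linarith)]
  calc ‖Complex.cosh w‖ ≤ 1 + |Real.sinh w.re| := norm_cosh_le w
    _ ≤ (1 / δ + 1) * |Real.sinh w.re| := by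
      rw [add_mul, one_mul, div_mul_eq_mul_div, one_mul]
      gcongr
      rwa [one_le_div hδ]
    _ ≤ _ := by gcongr

theorem cosh_ne_zero_of_abs_im_lt {w : ℂ} (h : |w.im| < Real.pi / 2) : Complex.cosh w ≠ 0 := by
  intro h0
  have := congrArg Complex.re (cosh_re_im w)
  rw [h0] at this
  have h1 := Real.cos_pos_of_mem_Ioo (abs_lt.1 h)
  have h2 := Real.cosh_pos w.re
  simp only [Complex.zero_re] at this
  nlinarith [mul_pos h2 h1]

theorem sinh_ne_zero_of_abs_im_lt {w : ℂ} (h : |w.im| < Real.pi) (hw : w ≠ 0) :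
    Complex.sinh w ≠ 0 := by
  intro h0
  have hr : w.re = 0 := by
    have := abs_re_le_norm_sinh w
    rw [h0, norm_zero] at this
    exact abs_nonpos_iff.1 this
  have h1 := congrArg Complex.im (sinh_re_im w)
  rw [h0, hr] at h1
  simp only [Complex.zero_im, Real.cosh_zero, one_mul] at h1
  have h2 := (Real.sin_eq_zero_iff_of_lt_of_lt (abs_lt.1 h).1 (abs_lt.1 h).2).1 h1.symm
  exact hw (Complex.ext hr h2)

/-! ### The regular part of the hyperbolic cotangent -/

/-- The regular part `coth w - 1 / w` of the hyperbolic cotangent at the origin, written with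
difference quotients so that it is defined (with value `0`) at `w = 0`. -/
def cothReg (w : ℂ) : ℂ :=
  dslope (fun w => Complex.cosh w - dslope Complex.sinh 0 w) 0 w / dslope Complex.sinh 0 w

/-- The strip `|Im w| < π`, in which `cothReg` is holomorphic. -/
def cothDomain : Set ℂ := {w | |w.im| < Real.pi}

theorem isOpen_cothDomain : IsOpen cothDomain :=
  isOpen_lt (by fun_prop) continuous_const

theorem dslope_sinh_zero : dslope Complex.sinh 0 0 = 1 := by simp

theorem differentiable_dslope_sinh : Differentiable ℂ (dslope Complex.sinh 0) := by
  rw [← differentiableOn_univ, Complex.differentiableOn_dslope univ_mem]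
  exact Complex.differentiable_sinh.differentiableOn

theorem cothReg_of_ne_zero {w : ℂ} (hw : w ≠ 0) (hd : w ∈ cothDomain) :
    cothReg w = Complex.cosh w / Complex.sinh w - 1 / w := by
  have hs := sinh_ne_zero_of_abs_im_lt hd hw
  rw [cothReg, dslope_of_ne _ hw, dslope_of_ne _ hw, slope_def_field, slope_def_field,
    dslope_sinh_zero, dslope_of_ne _ hw, slope_def_field]
  simp only [Complex.cosh_zero, Complex.sinh_zero, sub_self, sub_zero]
  field_simp

/-- The difference quotient of `sinh` is even, so its derivative at the origin vanishes. -/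
theorem cothReg_zero : cothReg 0 = 0 := by
  have h : HasDerivAt (dslope Complex.sinh 0) 0 0 := by
    have h1 := (differentiable_dslope_sinh 0).hasDerivAt
    have h2 : (fun w => dslope Complex.sinh 0 (-w)) = dslope Complex.sinh 0 := by
      ext w
      rcases eq_or_ne w 0 with rfl | hw
      · simp
      · rw [dslope_of_ne _ hw, dslope_of_ne _ (neg_ne_zero.2 hw), slope_def_field,
          slope_def_field]
        simp
    have h1' : HasDerivAt (dslope Complex.sinh 0) (deriv (dslope Complex.sinh 0) 0) (-0) := by
      rwa [neg_zero]
    have h3 := HasDerivAt.scomp (0 : ℂ) h1' (hasDerivAt_neg (0 : ℂ))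
    have h4 : HasDerivAt (dslope Complex.sinh 0)
        ((-1 : ℂ) • deriv (dslope Complex.sinh 0) 0) 0 := by
      rw [← h2]; simpa [Function.comp_def, h2] using h3
    have h5 := h1.unique h4
    have h6 : deriv (dslope Complex.sinh 0) 0 = 0 := by
      rw [neg_one_smul] at h5
      exact self_eq_neg.1 h5
    rwa [h6] at h1
  have h7 : HasDerivAt (fun w => Complex.cosh w - dslope Complex.sinh 0 w) 0 0 := by
    have := (Complex.hasDerivAt_cosh 0).sub h
    rw [Complex.sinh_zero, sub_zero] at this
    exact this
  rw [cothReg, dslope_same, h7.deriv, zero_div]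

theorem differentiableOn_cothReg : DifferentiableOn ℂ cothReg cothDomain := by
  have h1 : Differentiable ℂ (dslope (fun w => Complex.cosh w - dslope Complex.sinh 0 w) 0) := by
    rw [← differentiableOn_univ, Complex.differentiableOn_dslope univ_mem]
    exact (Complex.differentiable_cosh.sub differentiable_dslope_sinh).differentiableOn
  refine h1.differentiableOn.div differentiable_dslope_sinh.differentiableOn fun w hw => ?_
  rcases eq_or_ne w 0 with rfl | h0
  · simp
  · rw [dslope_of_ne _ h0, slope_def_field]
    simpa using ⟨sinh_ne_zero_of_abs_im_lt hw h0, h0⟩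

theorem hasDerivAt_cothReg {w : ℂ} (hd : w ∈ cothDomain) :
    HasDerivAt cothReg (deriv cothReg w) w :=
  (differentiableOn_cothReg.differentiableAt (isOpen_cothDomain.mem_nhds hd)).hasDerivAt

theorem differentiableOn_deriv_cothReg : DifferentiableOn ℂ (deriv cothReg) cothDomain :=
  differentiableOn_cothReg.deriv isOpen_cothDomain

theorem hasDerivAt_deriv_cothReg {w : ℂ} (hd : w ∈ cothDomain) :
    HasDerivAt (deriv cothReg) (deriv (deriv cothReg) w) w :=
  (differentiableOn_deriv_cothReg.differentiableAt (isOpen_cothDomain.mem_nhds hd)).hasDerivAt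

theorem continuousOn_deriv_deriv_cothReg : ContinuousOn (deriv (deriv cothReg)) cothDomain :=
  (differentiableOn_deriv_cothReg.deriv isOpen_cothDomain).continuousOn

theorem deriv_cothReg {w : ℂ} (hd : w ∈ cothDomain) (hw : w ≠ 0) :
    deriv cothReg w = -1 / Complex.sinh w ^ 2 + 1 / w ^ 2 := by
  have hs := sinh_ne_zero_of_abs_im_lt hd hw
  have h1 : cothReg =ᶠ[𝓝 w] fun w => Complex.cosh w / Complex.sinh w - w⁻¹ := by
    filter_upwards [isOpen_cothDomain.mem_nhds hd, isOpen_ne.mem_nhds hw] with v hv hv0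
    rw [cothReg_of_ne_zero hv0 hv, one_div]
  rw [h1.deriv_eq]
  refine (((Complex.hasDerivAt_cosh w).div (Complex.hasDerivAt_sinh w) hs).sub
    (hasDerivAt_inv hw)).deriv.trans ?_
  have := Complex.cosh_sq w
  field_simp
  rw [this]; ring

theorem deriv_deriv_cothReg {w : ℂ} (hd : w ∈ cothDomain) (hw : w ≠ 0) :
    deriv (deriv cothReg) w = 2 * Complex.cosh w / Complex.sinh w ^ 3 - 2 / w ^ 3 := by
  have hs := sinh_ne_zero_of_abs_im_lt hd hw
  have h1 : deriv cothReg =ᶠ[𝓝 w] fun w => -1 / Complex.sinh w ^ 2 + 1 / w ^ 2 := by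
    filter_upwards [isOpen_cothDomain.mem_nhds hd, isOpen_ne.mem_nhds hw] with v hv hv0
    rw [deriv_cothReg hv hv0]
  rw [h1.deriv_eq]
  refine (((hasDerivAt_const w (-1 : ℂ)).div ((Complex.hasDerivAt_sinh w).pow 2)
    (pow_ne_zero 2 hs)).add ((hasDerivAt_const w (1 : ℂ)).div ((hasDerivAt_id w).pow 2)
    (pow_ne_zero 2 hw))).deriv.trans ?_
  simp
  field_simp
  ring

theorem norm_deriv_cothReg_le {w : ℂ} (hd : w ∈ cothDomain) (hw : w.re ≠ 0) :
    ‖deriv cothReg w‖ ≤ 2 / |w.re| ^ 2 := by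
  have hw0 : w ≠ 0 := fun h => hw (by simp [h])
  have h0 : 0 < |w.re| := abs_pos.2 hw
  rw [deriv_cothReg hd hw0]
  refine (norm_add_le _ _).trans ?_
  rw [norm_div, norm_div, norm_neg, norm_one, norm_pow, norm_pow]
  have h1 := abs_re_le_norm_sinh w
  have h2 := Complex.abs_re_le_norm w
  calc 1 / ‖Complex.sinh w‖ ^ 2 + 1 / ‖w‖ ^ 2 ≤ 1 / |w.re| ^ 2 + 1 / |w.re| ^ 2 := by gcongr
    _ = _ := by ring

theorem norm_deriv_deriv_cothReg_le {w : ℂ} (hd : w ∈ cothDomain) {δ : ℝ} (hδ : 0 < δ)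
    (h : δ ≤ |w.re|) : ‖deriv (deriv cothReg) w‖ ≤ (4 / δ + 2) / |w.re| ^ 2 := by
  have h0 : 0 < |w.re| := hδ.trans_le h
  have hw0 : w ≠ 0 := fun h => h0.ne' (by simp [h])
  have hs := sinh_ne_zero_of_abs_im_lt hd hw0
  rw [deriv_deriv_cothReg hd hw0]
  refine (norm_sub_le _ _).trans ?_
  have h1 := abs_re_le_norm_sinh w
  have h2 := Complex.abs_re_le_norm w
  have e1 : 2 * Complex.cosh w / Complex.sinh w ^ 3 =
      2 * (Complex.cosh w / Complex.sinh w) * (1 / Complex.sinh w ^ 2) := by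
    field_simp
  have e2 : 2 / w ^ 3 = 2 * (1 / w) * (1 / w ^ 2) := by field_simp
  rw [e1, e2]
  simp only [norm_mul, Complex.norm_ofNat]
  calc 2 * ‖Complex.cosh w / Complex.sinh w‖ * ‖1 / Complex.sinh w ^ 2‖
        + 2 * ‖1 / w‖ * ‖1 / w ^ 2‖
      ≤ 2 * (1 / δ + 1) * (1 / |w.re| ^ 2) + 2 * (1 / δ) * (1 / |w.re| ^ 2) := by
        have := norm_cosh_div_sinh_le hδ h
        rw [norm_div 1, norm_div 1, norm_div 1, norm_pow, norm_pow, norm_one]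
        gcongr
        exact h.trans h2
    _ = _ := by ring

/-! ### Identities and derivatives for the hyperbolic tangent -/

theorem tanh_sub_coth {p q : ℂ} (hp : Complex.cosh p ≠ 0) (hq : Complex.sinh q ≠ 0) :
    Complex.tanh p - Complex.cosh q / Complex.sinh q =
      -Complex.cosh (p - q) / (Complex.cosh p * Complex.sinh q) := by
  rw [Complex.tanh_eq_sinh_div_cosh, Complex.cosh_sub]
  field_simp
  ring

theorem hasDerivAt_tanh {p : ℂ} (hp : Complex.cosh p ≠ 0) :
    HasDerivAt Complex.tanh (1 / Complex.cosh p ^ 2) p := by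
  have h1 : Complex.tanh = fun p => Complex.sinh p / Complex.cosh p := by
    ext p; exact Complex.tanh_eq_sinh_div_cosh p
  rw [h1]
  refine ((Complex.hasDerivAt_sinh p).div (Complex.hasDerivAt_cosh p) hp).congr_deriv ?_
  rw [← sq, ← sq, Complex.cosh_sq p]; ring

theorem hasDerivAt_sech_sq {p : ℂ} (hp : Complex.cosh p ≠ 0) :
    HasDerivAt (fun p => 1 / Complex.cosh p ^ 2)
      (-2 * (Complex.sinh p / Complex.cosh p) * (1 / Complex.cosh p ^ 2)) p := by
  refine ((hasDerivAt_const p (1 : ℂ)).div ((Complex.hasDerivAt_cosh p).pow 2)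
    (pow_ne_zero 2 hp)).congr_deriv ?_
  simp
  field_simp

/-! ### Gluing along the boundary of the strip -/

/-- The closed strip `|Im z| ≤ ℓ/2`. -/
def closedStrip (ℓ : ℝ) : Set ℂ := {z | |z.im| ≤ ℓ / 2}

theorem mem_strip {ℓ : ℝ} {z : ℂ} : z ∈ strip ℓ ↔ |z.im| < ℓ / 2 := by
  rw [abs_lt]; rfl

theorem isOpen_strip (ℓ : ℝ) : IsOpen (strip ℓ) := isOpen_Ioo.preimage Complex.continuous_im

theorem isClosed_closedStrip (ℓ : ℝ) : IsClosed (closedStrip ℓ) :=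
  isClosed_le (by fun_prop) continuous_const

theorem strip_subset_closedStrip (ℓ : ℝ) : strip ℓ ⊆ closedStrip ℓ :=
  fun _ hz => (mem_strip.1 hz).le

open Classical in
/-- The function equal to `F` in the open strip and to `H` elsewhere. -/
def glue (ℓ : ℝ) (F H : ℂ → ℂ) : ℂ → ℂ := (strip ℓ).piecewise F H

open Classical in
theorem glue_of_mem {ℓ : ℝ} {F H : ℂ → ℂ} {z : ℂ} (h : z ∈ strip ℓ) : glue ℓ F H z = F z :=
  piecewise_eq_of_mem _ _ _ h

open Classical in
theorem glue_of_notMem {ℓ : ℝ} {F H : ℂ → ℂ} {z : ℂ} (h : z ∉ strip ℓ) : glue ℓ F H z = H z :=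
  piecewise_eq_of_notMem _ _ _ h

open Classical in
theorem measurable_glue {ℓ : ℝ} {F H : ℂ → ℂ} (hF : ContinuousOn F (strip ℓ))
    (hH : ContinuousOn H (strip ℓ)ᶜ) : Measurable (glue ℓ F H) :=
  hF.measurable_piecewise hH (isOpen_strip ℓ).measurableSet

open Classical in
theorem continuous_glue {ℓ : ℝ} {F H : ℂ → ℂ} (hF : ContinuousOn F (closedStrip ℓ))
    (hH : ContinuousOn H (strip ℓ)ᶜ) (h : ∀ z : ℂ, |z.im| = ℓ / 2 → F z = H z) :
    Continuous (glue ℓ F H) := by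
  have hcl : closure (strip ℓ) ⊆ closedStrip ℓ :=
    closure_minimal (strip_subset_closedStrip ℓ) (isClosed_closedStrip ℓ)
  refine continuous_piecewise (fun z hz => h z ?_) (hF.mono hcl) ?_
  · rw [(isOpen_strip ℓ).frontier_eq] at hz
    exact le_antisymm (hcl hz.1) (not_lt.1 fun h' => hz.2 (mem_strip.2 h'))
  · rwa [(isOpen_strip ℓ).isClosed_compl.closure_eq]

/-- Differentiability of a glued function along a curve, off the boundary lines. -/
theorem hasDerivAt_glue_comp {ℓ : ℝ} {F H F' H' : ℂ → ℂ} {γ : ℝ → ℂ} {t : ℝ} {v : ℂ}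
    (hγ : HasDerivAt γ v t) (hz : (γ t).im ∉ ({ℓ / 2, -(ℓ / 2)} : Set ℝ))
    (hF : γ t ∈ strip ℓ → HasDerivAt (fun s => F (γ s)) (F' (γ t)) t)
    (hH : γ t ∉ strip ℓ → HasDerivAt (fun s => H (γ s)) (H' (γ t)) t) :
    HasDerivAt (fun s => glue ℓ F H (γ s)) (glue ℓ F' H' (γ t)) t := by
  by_cases h : γ t ∈ strip ℓ
  · rw [glue_of_mem h]
    refine (hF h).congr_of_eventuallyEq ?_
    filter_upwards [hγ.continuousAt.preimage_mem_nhds ((isOpen_strip ℓ).mem_nhds h)] with s hs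
      using glue_of_mem hs
  · rw [glue_of_notMem h]
    have h' : γ t ∈ (closedStrip ℓ)ᶜ := by
      intro h2
      have h3 : |(γ t).im| = ℓ / 2 := le_antisymm h2 (not_lt.1 fun h' => h (mem_strip.2 h'))
      rcases abs_choice (γ t).im with h4 | h4 <;> rw [h4] at h3
      · exact hz (by simp [h3])
      · exact hz (by simp [← h3])
    refine (hH h).congr_of_eventuallyEq ?_
    filter_upwards [hγ.continuousAt.preimage_mem_nhds
      ((isClosed_closedStrip ℓ).isOpen_compl.mem_nhds h')] with s hs
    exact glue_of_notMem fun h5 => hs (strip_subset_closedStrip ℓ h5)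

theorem norm_glue_mul_le {ℓ : ℝ} {F H : ℂ → ℂ} {k : ℕ}
    (hF : ∃ C, ∀ z ∈ closedStrip ℓ, ‖F z‖ * (1 + ‖z‖) ^ k ≤ C)
    (hH : ∃ C, ∀ z ∉ strip ℓ, ‖H z‖ * (1 + ‖z‖) ^ k ≤ C) :
    ∃ C, ∀ z, ‖glue ℓ F H z‖ * (1 + ‖z‖) ^ k ≤ C := by
  obtain ⟨C, hC⟩ := hF
  obtain ⟨D, hD⟩ := hH
  refine ⟨max C D, fun z => ?_⟩
  by_cases h : z ∈ strip ℓ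
  · rw [glue_of_mem h]
    exact (hC z (strip_subset_closedStrip ℓ h)).trans (le_max_left _ _)
  · rw [glue_of_notMem h]
    exact (hD z h).trans (le_max_right _ _)

/-- In a horizontal strip, decay in the real part is decay in the modulus. -/
theorem exists_bound_of_continuousOn_closedStrip {ℓ : ℝ} (hℓ : 0 < ℓ) {F : ℂ → ℂ}
    (hF : ContinuousOn F (closedStrip ℓ)) {k : ℕ} {C : ℝ}
    (h : ∀ z ∈ closedStrip ℓ, 1 ≤ |z.re| → ‖F z‖ ≤ C / |z.re| ^ k) :
    ∃ C, ∀ z ∈ closedStrip ℓ, ‖F z‖ * (1 + ‖z‖) ^ k ≤ C := by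
  have hK : IsCompact (Icc (-1 : ℝ) 1 ×ℂ Icc (-(ℓ / 2)) (ℓ / 2)) :=
    isCompact_Icc.reProdIm isCompact_Icc
  obtain ⟨M, hM⟩ := hK.exists_bound_of_continuousOn (hF.mono fun z hz => abs_le.2 hz.2)
  refine ⟨max M C * (2 + ℓ) ^ k, fun z hz => ?_⟩
  have hz' : |z.im| ≤ ℓ / 2 := hz
  have hn := Complex.norm_le_abs_re_add_abs_im z
  rcases le_total 1 |z.re| with h1 | h1
  · have h2 : 1 + ‖z‖ ≤ (2 + ℓ) * |z.re| := by nlinarith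
    calc ‖F z‖ * (1 + ‖z‖) ^ k ≤ C / |z.re| ^ k * ((2 + ℓ) * |z.re|) ^ k := by
          gcongr
          · exact (norm_nonneg _).trans (h z hz h1)
          · exact h z hz h1
      _ = C * (2 + ℓ) ^ k := by
          rw [mul_pow]
          have : |z.re| ^ k ≠ 0 := pow_ne_zero _ (by linarith)
          field_simp
      _ ≤ _ := by gcongr; exact le_max_right _ _
  · have h3 := hM z ⟨abs_le.1 h1, abs_le.1 hz'⟩
    have h4 : 0 ≤ max M C := (norm_nonneg _).trans (h3.trans (le_max_left _ _))
    have h5 : 1 + ‖z‖ ≤ 2 + ℓ := by linarith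
    calc ‖F z‖ * (1 + ‖z‖) ^ k ≤ max M C * (2 + ℓ) ^ k := by
          gcongr
          · exact h3.trans (le_max_left _ _)
      _ = _ := rfl

/-! ### Line derivatives of holomorphic and antiholomorphic functions -/

theorem hasDerivAt_re_of_holomorphic {φ : ℂ → ℂ} {d z : ℂ} (h : HasDerivAt φ d z) :
    HasDerivAt (fun x : ℝ => φ ⟨x, z.im⟩) d z.re := by
  refine (HasDerivAt.scomp z.re (g₁ := φ) h (hasDerivAt_mk_re z)).congr_deriv ?_
  simp

theorem hasDerivAt_im_of_holomorphic {φ : ℂ → ℂ} {d z : ℂ} (h : HasDerivAt φ d z) :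
    HasDerivAt (fun y : ℝ => φ ⟨z.re, y⟩) (Complex.I * d) z.im := by
  refine (HasDerivAt.scomp z.im (g₁ := φ) h (hasDerivAt_mk_im z)).congr_deriv ?_
  simp

theorem hasDerivAt_re_of_antiholomorphic {φ : ℂ → ℂ} {d z : ℂ} (h : HasDerivAt φ d (conj z)) :
    HasDerivAt (fun x : ℝ => φ (conj (⟨x, z.im⟩ : ℂ))) d z.re := by
  refine (HasDerivAt.scomp z.re (g₁ := φ) h
    (Complex.conjCLE.toContinuousLinearMap.hasFDerivAt.comp_hasDerivAt z.re
      (hasDerivAt_mk_re z))).congr_deriv ?_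
  simp

theorem hasDerivAt_im_of_antiholomorphic {φ : ℂ → ℂ} {d z : ℂ} (h : HasDerivAt φ d (conj z)) :
    HasDerivAt (fun y : ℝ => φ (conj (⟨z.re, y⟩ : ℂ))) (-Complex.I * d) z.im := by
  refine (HasDerivAt.scomp z.im (g₁ := φ) h
    (Complex.conjCLE.toContinuousLinearMap.hasFDerivAt.comp_hasDerivAt z.im
      (hasDerivAt_mk_im z))).congr_deriv ?_
  simp

/-! ### The explicit map -/

/-- The rate `π / (2ℓ)` at which the hyperbolic functions in the explicit map vary. -/
def rate (ℓ : ℝ) : ℝ := Real.pi / (2 * ℓ)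

theorem rate_pos {ℓ : ℝ} (hℓ : 0 < ℓ) : 0 < rate ℓ := by
  have := Real.pi_pos
  unfold rate; positivity

theorem rate_mul {ℓ : ℝ} (hℓ : 0 < ℓ) : rate ℓ * ℓ = Real.pi / 2 := by
  unfold rate; field_simp

/-- The argument `π / (2ℓ) (z + i y₀)` of the hyperbolic functions. -/
def arg (ℓ y₀ : ℝ) (z : ℂ) : ℂ := rate ℓ * (z + Complex.I * y₀)

/-- The open strip around `closedStrip ℓ` in which the inner formula is smooth. -/
def wideStrip (ℓ y₀ : ℝ) : Set ℂ := {z | |z.im| < ℓ - |y₀|}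

theorem isOpen_wideStrip (ℓ y₀ : ℝ) : IsOpen (wideStrip ℓ y₀) :=
  isOpen_lt (by fun_prop) continuous_const

theorem closedStrip_subset_wideStrip {ℓ y₀ : ℝ} (hy : |y₀| < ℓ / 2) :
    closedStrip ℓ ⊆ wideStrip ℓ y₀ := fun z (hz : |z.im| ≤ ℓ / 2) => by
  change |z.im| < _
  linarith

theorem conj_mem_wideStrip {ℓ y₀ : ℝ} {z : ℂ} (hz : z ∈ wideStrip ℓ y₀) :
    conj z ∈ wideStrip ℓ y₀ := by
  simpa [wideStrip] using hz

theorem arg_re (ℓ y₀ : ℝ) (z : ℂ) : (arg ℓ y₀ z).re = rate ℓ * z.re := by simp [arg]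

theorem abs_arg_re {ℓ : ℝ} (hℓ : 0 < ℓ) (y₀ : ℝ) (z : ℂ) :
    |(arg ℓ y₀ z).re| = rate ℓ * |z.re| := by
  rw [arg_re, abs_mul, abs_of_pos (rate_pos hℓ)]

theorem abs_arg_im_lt {ℓ y₀ : ℝ} (hℓ : 0 < ℓ) {z : ℂ} (hz : z ∈ wideStrip ℓ y₀) :
    |(arg ℓ y₀ z).im| < Real.pi / 2 := by
  have h1 : (arg ℓ y₀ z).im = rate ℓ * (z.im + y₀) := by simp [arg]
  have hz' : |z.im| < ℓ - |y₀| := hz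
  rw [h1, abs_mul, abs_of_pos (rate_pos hℓ), ← rate_mul hℓ]
  exact mul_lt_mul_of_pos_left ((abs_add_le _ _).trans_lt (by linarith)) (rate_pos hℓ)

theorem cosh_arg_ne_zero {ℓ y₀ : ℝ} (hℓ : 0 < ℓ) {z : ℂ} (hz : z ∈ wideStrip ℓ y₀) :
    Complex.cosh (arg ℓ y₀ z) ≠ 0 := cosh_ne_zero_of_abs_im_lt (abs_arg_im_lt hℓ hz)

theorem arg_mem_cothDomain {ℓ y₀ : ℝ} (hℓ : 0 < ℓ) {z : ℂ} (hz : z ∈ wideStrip ℓ y₀) :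
    arg ℓ y₀ z ∈ cothDomain :=
  (abs_arg_im_lt hℓ hz).trans (by linarith [Real.pi_pos])

theorem hasDerivAt_arg (ℓ y₀ : ℝ) (z : ℂ) : HasDerivAt (arg ℓ y₀) (rate ℓ) z := by
  simpa using! ((hasDerivAt_id z).add_const (Complex.I * (y₀ : ℂ))).const_mul (rate ℓ : ℂ)

theorem continuous_arg (ℓ y₀ : ℝ) : Continuous (arg ℓ y₀) := by
  unfold arg; fun_prop

/-- The holomorphic part of the inner formula. -/
def hol (ℓ y₀ : ℝ) (z : ℂ) : ℂ := 2 * rate ℓ * Complex.tanh (arg ℓ y₀ z)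

/-- The derivative of `hol`. -/
def hol₁ (ℓ y₀ : ℝ) (z : ℂ) : ℂ := 2 * rate ℓ ^ 2 * (1 / Complex.cosh (arg ℓ y₀ z) ^ 2)

/-- The second derivative of `hol`. -/
def hol₂ (ℓ y₀ : ℝ) (z : ℂ) : ℂ := 2 * rate ℓ ^ 3 *
  (-2 * (Complex.sinh (arg ℓ y₀ z) / Complex.cosh (arg ℓ y₀ z)) *
    (1 / Complex.cosh (arg ℓ y₀ z) ^ 2))

/-- The antiholomorphic part of the inner formula, as a holomorphic function of `conj z`. -/
def anti (ℓ y₀ : ℝ) (v : ℂ) : ℂ := -2 * rate ℓ * cothReg (arg ℓ y₀ v)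

/-- The derivative of `anti`. -/
def anti₁ (ℓ y₀ : ℝ) (v : ℂ) : ℂ := -2 * rate ℓ ^ 2 * deriv cothReg (arg ℓ y₀ v)

/-- The second derivative of `anti`. -/
def anti₂ (ℓ y₀ : ℝ) (v : ℂ) : ℂ := -2 * rate ℓ ^ 3 * deriv (deriv cothReg) (arg ℓ y₀ v)

/-- The prescribed tail, as a holomorphic function of `conj z`. -/
def tail (y₀ : ℝ) (v : ℂ) : ℂ := 2 / (v + Complex.I * y₀)

/-- The derivative of `tail`. -/
def tail₁ (y₀ : ℝ) (v : ℂ) : ℂ := -2 / (v + Complex.I * y₀) ^ 2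

/-- The second derivative of `tail`. -/
def tail₂ (y₀ : ℝ) (v : ℂ) : ℂ := 4 / (v + Complex.I * y₀) ^ 3

theorem hasDerivAt_hol {ℓ y₀ : ℝ} (hℓ : 0 < ℓ) {z : ℂ} (hz : z ∈ wideStrip ℓ y₀) :
    HasDerivAt (hol ℓ y₀) (hol₁ ℓ y₀ z) z := by
  refine (((hasDerivAt_tanh (cosh_arg_ne_zero hℓ hz)).comp z (hasDerivAt_arg ℓ y₀ z)).const_mul
    (2 * rate ℓ : ℂ)).congr_deriv ?_
  rw [hol₁]; ring

theorem hasDerivAt_hol₁ {ℓ y₀ : ℝ} (hℓ : 0 < ℓ) {z : ℂ} (hz : z ∈ wideStrip ℓ y₀) :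
    HasDerivAt (hol₁ ℓ y₀) (hol₂ ℓ y₀ z) z := by
  refine (((hasDerivAt_sech_sq (cosh_arg_ne_zero hℓ hz)).comp z (hasDerivAt_arg ℓ y₀ z)).const_mul
    (2 * rate ℓ ^ 2 : ℂ)).congr_deriv ?_
  rw [hol₂]; ring

theorem hasDerivAt_anti {ℓ y₀ : ℝ} (hℓ : 0 < ℓ) {v : ℂ} (hv : v ∈ wideStrip ℓ y₀) :
    HasDerivAt (anti ℓ y₀) (anti₁ ℓ y₀ v) v := by
  refine (((hasDerivAt_cothReg (arg_mem_cothDomain hℓ hv)).comp v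
    (hasDerivAt_arg ℓ y₀ v)).const_mul (-2 * rate ℓ : ℂ)).congr_deriv ?_
  rw [anti₁]; ring

theorem hasDerivAt_anti₁ {ℓ y₀ : ℝ} (hℓ : 0 < ℓ) {v : ℂ} (hv : v ∈ wideStrip ℓ y₀) :
    HasDerivAt (anti₁ ℓ y₀) (anti₂ ℓ y₀ v) v := by
  refine (((hasDerivAt_deriv_cothReg (arg_mem_cothDomain hℓ hv)).comp v
    (hasDerivAt_arg ℓ y₀ v)).const_mul (-2 * rate ℓ ^ 2 : ℂ)).congr_deriv ?_
  rw [anti₂]; ring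

theorem continuousOn_hol₂ {ℓ y₀ : ℝ} (hℓ : 0 < ℓ) : ContinuousOn (hol₂ ℓ y₀) (wideStrip ℓ y₀) := by
  unfold hol₂
  have h1 : ContinuousOn (fun z => Complex.cosh (arg ℓ y₀ z)) (wideStrip ℓ y₀) :=
    (Complex.continuous_cosh.comp (continuous_arg ℓ y₀)).continuousOn
  have h2 : ContinuousOn (fun z => Complex.sinh (arg ℓ y₀ z)) (wideStrip ℓ y₀) :=
    (Complex.continuous_sinh.comp (continuous_arg ℓ y₀)).continuousOn
  have h3 : ∀ z ∈ wideStrip ℓ y₀, Complex.cosh (arg ℓ y₀ z) ≠ 0 := fun z hz =>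
    cosh_arg_ne_zero hℓ hz
  exact continuousOn_const.mul ((continuousOn_const.mul (h2.div h1 h3)).mul
    (continuousOn_const.div (h1.pow 2) fun z hz => pow_ne_zero 2 (h3 z hz)))

theorem continuousOn_anti₂ {ℓ y₀ : ℝ} (hℓ : 0 < ℓ) : ContinuousOn (anti₂ ℓ y₀) (wideStrip ℓ y₀) :=
  continuousOn_const.mul (continuousOn_deriv_deriv_cothReg.comp
    (continuous_arg ℓ y₀).continuousOn fun _ hz => arg_mem_cothDomain hℓ hz)

theorem hasDerivAt_tail {y₀ : ℝ} {v : ℂ} (hv : v + Complex.I * y₀ ≠ 0) :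
    HasDerivAt (tail y₀) (tail₁ y₀ v) v := by
  refine ((hasDerivAt_const v (2 : ℂ)).div ((hasDerivAt_id v).add_const _) hv).congr_deriv ?_
  simp [tail₁]

theorem hasDerivAt_tail₁ {y₀ : ℝ} {v : ℂ} (hv : v + Complex.I * y₀ ≠ 0) :
    HasDerivAt (tail₁ y₀) (tail₂ y₀ v) v := by
  refine ((hasDerivAt_const v (-2 : ℂ)).div (((hasDerivAt_id v).add_const _).pow 2)
    (pow_ne_zero 2 hv)).congr_deriv ?_
  simp [tail₂]
  field_simp
  norm_num

theorem conj_add_ne_zero {ℓ y₀ : ℝ} (hy : |y₀| < ℓ / 2) {z : ℂ} (hz : z ∉ strip ℓ) :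
    conj z + Complex.I * y₀ ≠ 0 := by
  intro h
  have h1 := congrArg Complex.im h
  simp at h1
  exact hz (mem_strip.2 (by rwa [show z.im = y₀ by linarith]))

/-- Off the strip the modulus is controlled by the distance to the centre. -/
theorem exists_one_add_norm_le {ℓ y₀ : ℝ} (hy : |y₀| < ℓ / 2) :
    ∃ K, 0 ≤ K ∧ ∀ z ∉ strip ℓ, 1 + ‖z‖ ≤ K * ‖conj z + Complex.I * y₀‖ := by
  have hδ : 0 < ℓ / 2 - |y₀| := by linarith
  refine ⟨(1 + |y₀|) / (ℓ / 2 - |y₀|) + 1, by positivity, fun z hz => ?_⟩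
  rw [mem_strip, not_lt] at hz
  have h1 : ℓ / 2 - |y₀| ≤ ‖conj z + Complex.I * y₀‖ := by
    refine le_trans ?_ (Complex.abs_im_le_norm _)
    have : (conj z + Complex.I * y₀).im = -(z.im - y₀) := by simp; ring
    rw [this, abs_neg]
    exact (by linarith : _ ≤ |z.im| - |y₀|).trans (abs_sub_abs_le_abs_sub _ _)
  have h2 : ‖z‖ ≤ ‖conj z + Complex.I * y₀‖ + |y₀| := by
    calc ‖z‖ = ‖(conj z + Complex.I * y₀) - Complex.I * y₀‖ := by simp
      _ ≤ ‖conj z + Complex.I * y₀‖ + ‖Complex.I * (y₀ : ℂ)‖ := norm_sub_le _ _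
      _ = _ := by simp
  have h3 : 1 + |y₀| ≤ (1 + |y₀|) / (ℓ / 2 - |y₀|) * ‖conj z + Complex.I * y₀‖ := by
    rw [div_mul_eq_mul_div, le_div_iff₀ hδ]
    gcongr
  linarith

theorem exists_bound_const_div_pow {ℓ y₀ : ℝ} (hy : |y₀| < ℓ / 2) (a : ℂ) (k m : ℕ)
    (hkm : k ≤ m) :
    ∃ C, ∀ z ∉ strip ℓ, ‖a / (conj z + Complex.I * y₀) ^ m‖ * (1 + ‖z‖) ^ k ≤ C := by
  obtain ⟨K, hK, h⟩ := exists_one_add_norm_le hy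
  refine ⟨‖a‖ * K ^ m, fun z hz => ?_⟩
  have hw := conj_add_ne_zero hy hz
  calc ‖a / (conj z + Complex.I * y₀) ^ m‖ * (1 + ‖z‖) ^ k
      ≤ ‖a / (conj z + Complex.I * y₀) ^ m‖ * (1 + ‖z‖) ^ m := by
        gcongr
        linarith [norm_nonneg z]
    _ ≤ ‖a / (conj z + Complex.I * y₀) ^ m‖ * (K * ‖conj z + Complex.I * y₀‖) ^ m := by
        gcongr
        exact h z hz
    _ = ‖a‖ * K ^ m := by
        rw [norm_div, norm_pow, mul_pow]
        have : ‖conj z + Complex.I * y₀‖ ^ m ≠ 0 := pow_ne_zero _ (norm_ne_zero_iff.2 hw)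
        field_simp

/-- The inner formula minus the tail is a multiple of `cos (π y / ℓ)`. -/
theorem hol_add_anti {ℓ y₀ : ℝ} (hℓ : 0 < ℓ) {z : ℂ} (hz : z ∈ wideStrip ℓ y₀)
    (hw : conj z + Complex.I * y₀ ≠ 0) :
    hol ℓ y₀ z + anti ℓ y₀ (conj z) = tail y₀ (conj z) - 2 * rate ℓ *
      (Real.cos (2 * rate ℓ * z.im) /
        (Complex.cosh (arg ℓ y₀ z) * Complex.sinh (arg ℓ y₀ (conj z)))) := by
  have hc : (rate ℓ : ℂ) ≠ 0 := by exact_mod_cast (rate_pos hℓ).ne'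
  have hq0 : arg ℓ y₀ (conj z) ≠ 0 := mul_ne_zero hc hw
  have hqd := arg_mem_cothDomain hℓ (conj_mem_wideStrip hz)
  have h := tanh_sub_coth (cosh_arg_ne_zero hℓ hz) (sinh_ne_zero_of_abs_im_lt hqd hq0)
  have h1 : arg ℓ y₀ z - arg ℓ y₀ (conj z) = ((2 * rate ℓ * z.im : ℝ) : ℂ) * Complex.I := by
    apply Complex.ext <;> simp [arg]
    ring
  rw [h1, Complex.cosh_mul_I, ← Complex.ofReal_cos] at h
  have h2 : 2 * (rate ℓ : ℂ) * (1 / arg ℓ y₀ (conj z)) = tail y₀ (conj z) := by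
    rw [arg, tail]; field_simp
  rw [hol, anti, cothReg_of_ne_zero hq0 hqd, ← h2]
  rw [neg_div] at h
  linear_combination (2 * (rate ℓ : ℂ)) * h

theorem cos_boundary {ℓ : ℝ} (hℓ : 0 < ℓ) {z : ℂ} (hz : |z.im| = ℓ / 2) :
    Real.cos (2 * rate ℓ * z.im) = 0 := by
  rw [← Real.cos_abs, abs_mul, abs_of_pos (by linarith [rate_pos hℓ]), hz]
  rw [show 2 * rate ℓ * (ℓ / 2) = rate ℓ * ℓ by ring, rate_mul hℓ, Real.cos_pi_div_two]

theorem notMem_strip_of_abs_im_eq {ℓ : ℝ} {z : ℂ} (hz : |z.im| = ℓ / 2) : z ∉ strip ℓ :=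
  fun h => (mem_strip.1 h).ne hz

/-- The inner formula and the tail agree on the boundary lines. -/
theorem hol_add_anti_boundary {ℓ y₀ : ℝ} (hℓ : 0 < ℓ) (hy : |y₀| < ℓ / 2) {z : ℂ}
    (hz : |z.im| = ℓ / 2) : hol ℓ y₀ z + anti ℓ y₀ (conj z) = tail y₀ (conj z) := by
  rw [hol_add_anti hℓ (closedStrip_subset_wideStrip hy hz.le)
    (conj_add_ne_zero hy (notMem_strip_of_abs_im_eq hz)), cos_boundary hℓ hz]
  simp

/-- The tangential derivatives of the inner formula and of the tail agree on the boundary. -/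
theorem hol₁_add_anti₁_boundary {ℓ y₀ : ℝ} (hℓ : 0 < ℓ) (hy : |y₀| < ℓ / 2) {z : ℂ}
    (hz : |z.im| = ℓ / 2) : hol₁ ℓ y₀ z + anti₁ ℓ y₀ (conj z) = tail₁ y₀ (conj z) := by
  have hzw := closedStrip_subset_wideStrip hy hz.le
  have hw := conj_add_ne_zero hy (notMem_strip_of_abs_im_eq hz)
  have hc : (rate ℓ : ℂ) ≠ 0 := by exact_mod_cast (rate_pos hℓ).ne'
  have hq0 : arg ℓ y₀ (conj z) ≠ 0 := mul_ne_zero hc hw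
  have hqd := arg_mem_cothDomain hℓ (conj_mem_wideStrip hzw)
  have hs := sinh_ne_zero_of_abs_im_lt hqd hq0
  have h1 : arg ℓ y₀ z - arg ℓ y₀ (conj z) = ((2 * rate ℓ * z.im : ℝ) : ℂ) * Complex.I := by
    apply Complex.ext <;> simp [arg]
    ring
  have h2 : Complex.cosh (arg ℓ y₀ z - arg ℓ y₀ (conj z)) = 0 := by
    rw [h1, Complex.cosh_mul_I, ← Complex.ofReal_cos, cos_boundary hℓ hz, Complex.ofReal_zero]
  have h3 := Complex.cosh_sq_sub_sinh_sq (arg ℓ y₀ z - arg ℓ y₀ (conj z))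
  -- On the boundary the two arguments differ by `± i π / 2`, hence `cosh² p = - sinh² q`.
  have h4 := Complex.cosh_add (arg ℓ y₀ z - arg ℓ y₀ (conj z)) (arg ℓ y₀ (conj z))
  rw [sub_add_cancel, h2, zero_mul, zero_add] at h4
  have h5 : Complex.cosh (arg ℓ y₀ z) ^ 2 = -Complex.sinh (arg ℓ y₀ (conj z)) ^ 2 := by
    rw [h4, mul_pow]
    rw [h2] at h3
    linear_combination -Complex.sinh (arg ℓ y₀ (conj z)) ^ 2 * h3
  have h6 : 2 * (rate ℓ : ℂ) ^ 2 * (1 / arg ℓ y₀ (conj z) ^ 2) = -tail₁ y₀ (conj z) := by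
    rw [arg, tail₁]; field_simp
  rw [hol₁, anti₁, deriv_cothReg hqd hq0, h5]
  have : tail₁ y₀ (conj z) = -(2 * (rate ℓ : ℂ) ^ 2 * (1 / arg ℓ y₀ (conj z) ^ 2)) := by
    rw [h6, neg_neg]
  rw [this]
  field_simp
  ring

/-! ### Polynomial decay -/

/-- `g = O((1 + |z|)⁻ᵏ)`, uniformly on the plane. -/
def Decays (k : ℕ) (g : ℂ → ℂ) : Prop := ∃ C, ∀ z, ‖g z‖ * (1 + ‖z‖) ^ k ≤ C

theorem Decays.mono {k m : ℕ} {g : ℂ → ℂ} (h : Decays m g) (hkm : k ≤ m) : Decays k g := by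
  obtain ⟨C, hC⟩ := h
  refine ⟨C, fun z => le_trans ?_ (hC z)⟩
  gcongr
  linarith [norm_nonneg z]

theorem Decays.add {k : ℕ} {f g : ℂ → ℂ} (hf : Decays k f) (hg : Decays k g) :
    Decays k (fun z => f z + g z) := by
  obtain ⟨C, hC⟩ := hf
  obtain ⟨D, hD⟩ := hg
  refine ⟨C + D, fun z => le_trans ?_ (add_le_add (hC z) (hD z))⟩
  rw [← add_mul]
  gcongr
  exact norm_add_le _ _

theorem Decays.mul {k m : ℕ} {f g : ℂ → ℂ} (hf : Decays k f) (hg : Decays m g) :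
    Decays (k + m) (fun z => f z * g z) := by
  obtain ⟨C, hC⟩ := hf
  obtain ⟨D, hD⟩ := hg
  refine ⟨C * D, fun z => ?_⟩
  have hC0 : 0 ≤ C := le_trans (by positivity) (hC z)
  calc ‖f z * g z‖ * (1 + ‖z‖) ^ (k + m)
      = (‖f z‖ * (1 + ‖z‖) ^ k) * (‖g z‖ * (1 + ‖z‖) ^ m) := by rw [norm_mul, pow_add]; ring
    _ ≤ C * D := mul_le_mul (hC z) (hD z) (by positivity) hC0

theorem Decays.const_mul {k : ℕ} {f : ℂ → ℂ} (hf : Decays k f) (a : ℂ) :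
    Decays k (fun z => a * f z) := by
  obtain ⟨C, hC⟩ := hf
  refine ⟨‖a‖ * C, fun z => ?_⟩
  rw [norm_mul, mul_assoc]
  gcongr
  exact hC z

theorem Decays.sub {k : ℕ} {f g : ℂ → ℂ} (hf : Decays k f) (hg : Decays k g) :
    Decays k (fun z => f z - g z) := by
  simpa [sub_eq_add_neg] using hf.add (hg.const_mul (-1))

theorem Decays.conj {k : ℕ} {f : ℂ → ℂ} (hf : Decays k f) : Decays k (fun z => conj (f z)) := by
  obtain ⟨C, hC⟩ := hf
  exact ⟨C, fun z => by simpa using hC z⟩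

theorem Decays.bounded {k : ℕ} {f : ℂ → ℂ} (hf : Decays k f) : ∃ C, ∀ z, ‖f z‖ ≤ C := by
  obtain ⟨C, hC⟩ := hf.mono (Nat.zero_le k)
  exact ⟨C, fun z => by simpa using hC z⟩

theorem Decays.integrable {k : ℕ} (hk : 3 ≤ k) {f : ℂ → ℂ} (hf : Decays k f) (hm : Measurable f) :
    Integrable f := by
  obtain ⟨C, hC⟩ := hf.mono hk
  have h := (integrable_one_add_norm (E := ℂ) (μ := volume) (r := 3)
    (by rw [Complex.finrank_real_complex]; norm_num)).const_mul C
  refine h.mono' hm.aestronglyMeasurable (Eventually.of_forall fun z => ?_)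
  have hp : 0 < 1 + ‖z‖ := by positivity
  rw [Real.rpow_neg hp.le, ← div_eq_mul_inv, le_div_iff₀ (Real.rpow_pos_of_pos hp _)]
  exact_mod_cast hC z

theorem Decays.tendsto_zero {k : ℕ} (hk : 1 ≤ k) {f : ℂ → ℂ} (hf : Decays k f) :
    Tendsto f (cocompact ℂ) (𝓝 0) := by
  obtain ⟨C, hC⟩ := hf.mono hk
  have h1 : Tendsto (fun z : ℂ => C / (1 + ‖z‖)) (cocompact ℂ) (𝓝 0) :=
    (tendsto_const_nhds (x := C)).div_atTop
      (tendsto_atTop_add_const_left _ 1 tendsto_norm_cocompact_atTop)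
  refine squeeze_zero_norm (fun z => ?_) h1
  rw [le_div_iff₀ (by positivity)]
  simpa using hC z

/-! ### The extremal map and its derivatives -/

/-- The extremal map, equal to `stripMap` everywhere; in this form the singularity of the inner
formula has been removed. -/
def extremal (ℓ y₀ : ℝ) : ℂ → ℂ :=
  glue ℓ (fun z => hol ℓ y₀ z + anti ℓ y₀ (conj z)) (fun z => tail y₀ (conj z))

/-- The Wirtinger derivative `∂` of the extremal map. -/
def dHol (ℓ y₀ : ℝ) : ℂ → ℂ := glue ℓ (hol₁ ℓ y₀) (fun _ => 0)

/-- The Wirtinger derivative `∂̄` of the extremal map. -/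
def dAnti (ℓ y₀ : ℝ) : ℂ → ℂ :=
  glue ℓ (fun z => anti₁ ℓ y₀ (conj z)) (fun z => tail₁ y₀ (conj z))

/-- The derivative of `dHol` off the boundary lines. -/
def ddHol (ℓ y₀ : ℝ) : ℂ → ℂ := glue ℓ (hol₂ ℓ y₀) (fun _ => 0)

/-- The derivative of `dAnti` in `conj z` off the boundary lines. -/
def ddAnti (ℓ y₀ : ℝ) : ℂ → ℂ :=
  glue ℓ (fun z => anti₂ ℓ y₀ (conj z)) (fun z => tail₂ y₀ (conj z))

theorem glue_add {ℓ : ℝ} (F H F' H' : ℂ → ℂ) (z : ℂ) :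
    glue ℓ (fun z => F z + F' z) (fun z => H z + H' z) z = glue ℓ F H z + glue ℓ F' H' z := by
  by_cases h : z ∈ strip ℓ
  · simp only [glue_of_mem h]
  · simp only [glue_of_notMem h]

section

variable {ℓ y₀ : ℝ}

theorem norm_one_div_cosh_sq_le (hℓ : 0 < ℓ) {z : ℂ} (h : 1 ≤ |z.re|) :
    ‖1 / Complex.cosh (arg ℓ y₀ z) ^ 2‖ ≤ 1 / (rate ℓ * |z.re|) ^ 2 := by
  have h1 := abs_re_le_norm_cosh (arg ℓ y₀ z)
  rw [abs_arg_re hℓ] at h1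
  have := rate_pos hℓ
  rw [norm_div, norm_one, norm_pow]
  gcongr

theorem decays_dHol (hℓ : 0 < ℓ) (hy : |y₀| < ℓ / 2) : Decays 2 (dHol ℓ y₀) := by
  have hc := rate_pos hℓ
  refine norm_glue_mul_le (exists_bound_of_continuousOn_closedStrip hℓ (C := 2)
    (fun z hz => ((hasDerivAt_hol₁ hℓ
      (closedStrip_subset_wideStrip hy hz)).continuousAt).continuousWithinAt) fun z hz h => ?_)
    ⟨0, fun z _ => by simp⟩
  have h2 : 0 < |z.re| := by linarith
  calc ‖hol₁ ℓ y₀ z‖ = 2 * rate ℓ ^ 2 * ‖1 / Complex.cosh (arg ℓ y₀ z) ^ 2‖ := by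
        rw [hol₁, norm_mul]; simp
    _ ≤ 2 * rate ℓ ^ 2 * (1 / (rate ℓ * |z.re|) ^ 2) := by
        gcongr; exact norm_one_div_cosh_sq_le hℓ h
    _ = 2 / |z.re| ^ 2 := by field_simp

theorem decays_ddHol (hℓ : 0 < ℓ) (hy : |y₀| < ℓ / 2) : Decays 2 (ddHol ℓ y₀) := by
  have hc := rate_pos hℓ
  refine norm_glue_mul_le (exists_bound_of_continuousOn_closedStrip hℓ
    (C := 4 * rate ℓ * (1 / rate ℓ + 1))
    ((continuousOn_hol₂ hℓ).mono (closedStrip_subset_wideStrip hy)) fun z hz h => ?_)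
    ⟨0, fun z _ => by simp⟩
  have h2 : 0 < |z.re| := by linarith
  have h3 : rate ℓ ≤ |(arg ℓ y₀ z).re| := by
    rw [abs_arg_re hℓ]; nlinarith
  calc ‖hol₂ ℓ y₀ z‖ = 4 * rate ℓ ^ 3 * (‖Complex.sinh (arg ℓ y₀ z) / Complex.cosh (arg ℓ y₀ z)‖
          * ‖1 / Complex.cosh (arg ℓ y₀ z) ^ 2‖) := by
        rw [hol₂, norm_mul, norm_mul, norm_mul]
        simp [-norm_inv, -norm_pow, -norm_div]
        rw [norm_pow, Complex.norm_real, Real.norm_of_nonneg hc.le]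
        ring
    _ ≤ 4 * rate ℓ ^ 3 * ((1 / rate ℓ + 1) * (1 / (rate ℓ * |z.re|) ^ 2)) := by
        gcongr
        · exact norm_sinh_div_cosh_le hc h3
        · exact norm_one_div_cosh_sq_le hℓ h
    _ = 4 * rate ℓ * (1 / rate ℓ + 1) / |z.re| ^ 2 := by field_simp

theorem continuousOn_comp_conj {φ : ℂ → ℂ} (hy : |y₀| < ℓ / 2)
    (h : ContinuousOn φ (wideStrip ℓ y₀)) : ContinuousOn (fun z => φ (conj z)) (closedStrip ℓ) :=
  h.comp Complex.continuous_conj.continuousOn fun _ hz =>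
    conj_mem_wideStrip (closedStrip_subset_wideStrip hy hz)

theorem decays_dAnti (hℓ : 0 < ℓ) (hy : |y₀| < ℓ / 2) : Decays 2 (dAnti ℓ y₀) := by
  have hc := rate_pos hℓ
  refine norm_glue_mul_le (exists_bound_of_continuousOn_closedStrip hℓ (C := 4)
    (continuousOn_comp_conj hy fun _ hz =>
      ((hasDerivAt_anti₁ hℓ hz).continuousAt).continuousWithinAt) fun z hz h => ?_)
    (exists_bound_const_div_pow hy (-2) 2 2 le_rfl)
  have h2 : 0 < |z.re| := by linarith
  have h3 := norm_deriv_cothReg_le (w := arg ℓ y₀ (conj z)) (arg_mem_cothDomain hℓ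
    (conj_mem_wideStrip (closedStrip_subset_wideStrip hy hz)))
    (by rw [← abs_pos, abs_arg_re hℓ, Complex.conj_re]; positivity)
  rw [abs_arg_re hℓ, Complex.conj_re] at h3
  calc ‖anti₁ ℓ y₀ (conj z)‖ = 2 * rate ℓ ^ 2 * ‖deriv cothReg (arg ℓ y₀ (conj z))‖ := by
        rw [anti₁, norm_mul]; simp
    _ ≤ 2 * rate ℓ ^ 2 * (2 / (rate ℓ * |z.re|) ^ 2) := by gcongr
    _ = 4 / |z.re| ^ 2 := by field_simp; norm_num

theorem decays_ddAnti (hℓ : 0 < ℓ) (hy : |y₀| < ℓ / 2) : Decays 2 (ddAnti ℓ y₀) := by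
  have hc := rate_pos hℓ
  refine norm_glue_mul_le (exists_bound_of_continuousOn_closedStrip hℓ
    (C := 2 * rate ℓ * (4 / rate ℓ + 2))
    (continuousOn_comp_conj hy (continuousOn_anti₂ hℓ)) fun z hz h => ?_)
    (exists_bound_const_div_pow hy 4 2 3 (by norm_num))
  have h2 : 0 < |z.re| := by linarith
  have h3 := norm_deriv_deriv_cothReg_le (w := arg ℓ y₀ (conj z)) (arg_mem_cothDomain hℓ
    (conj_mem_wideStrip (closedStrip_subset_wideStrip hy hz))) hc
    (by rw [abs_arg_re hℓ, Complex.conj_re]; nlinarith)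
  rw [abs_arg_re hℓ, Complex.conj_re] at h3
  calc ‖anti₂ ℓ y₀ (conj z)‖
        = 2 * rate ℓ ^ 3 * ‖deriv (deriv cothReg) (arg ℓ y₀ (conj z))‖ := by
        rw [anti₂, norm_mul]; simp [abs_of_pos hc]
    _ ≤ 2 * rate ℓ ^ 3 * ((4 / rate ℓ + 2) / (rate ℓ * |z.re|) ^ 2) := by gcongr
    _ = 2 * rate ℓ * (4 / rate ℓ + 2) / |z.re| ^ 2 := by field_simp

theorem continuousOn_inner (hℓ : 0 < ℓ) (hy : |y₀| < ℓ / 2) :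
    ContinuousOn (fun z => hol ℓ y₀ z + anti ℓ y₀ (conj z)) (closedStrip ℓ) :=
  ContinuousOn.add
    (fun _ hz => ((hasDerivAt_hol hℓ
      (closedStrip_subset_wideStrip hy hz)).continuousAt).continuousWithinAt)
    (continuousOn_comp_conj hy fun _ hz =>
      ((hasDerivAt_anti hℓ hz).continuousAt).continuousWithinAt)

theorem continuousOn_inner₁ (hℓ : 0 < ℓ) (hy : |y₀| < ℓ / 2) :
    ContinuousOn (fun z => hol₁ ℓ y₀ z + anti₁ ℓ y₀ (conj z)) (closedStrip ℓ) :=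
  ContinuousOn.add
    (fun _ hz => ((hasDerivAt_hol₁ hℓ
      (closedStrip_subset_wideStrip hy hz)).continuousAt).continuousWithinAt)
    (continuousOn_comp_conj hy fun _ hz =>
      ((hasDerivAt_anti₁ hℓ hz).continuousAt).continuousWithinAt)

theorem norm_tail_le {z : ℂ} (h : 1 ≤ |z.re|) :
    ‖tail y₀ (conj z)‖ ≤ 2 / |z.re| := by
  have h1 : |z.re| ≤ ‖conj z + Complex.I * y₀‖ := by
    simpa using Complex.abs_re_le_norm (conj z + Complex.I * y₀)
  rw [tail, norm_div, Complex.norm_ofNat]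
  gcongr

theorem decays_extremal (hℓ : 0 < ℓ) (hy : |y₀| < ℓ / 2) : Decays 1 (extremal ℓ y₀) := by
  have hc := rate_pos hℓ
  refine norm_glue_mul_le (exists_bound_of_continuousOn_closedStrip hℓ (C := 2 + 2 / rate ℓ)
    (continuousOn_inner hℓ hy) fun z hz h => ?_)
    (by simpa [tail] using exists_bound_const_div_pow hy 2 1 1 le_rfl)
  have h2 : 0 < |z.re| := by linarith
  have hw : conj z + Complex.I * y₀ ≠ 0 := by
    intro h0
    have := congrArg Complex.re h0
    simp at this
    simp [this] at h2
  rw [hol_add_anti hℓ (closedStrip_subset_wideStrip hy hz) hw, pow_one]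
  have h3 := abs_re_le_norm_cosh (arg ℓ y₀ z)
  have h4 := abs_re_le_norm_sinh (arg ℓ y₀ (conj z))
  rw [abs_arg_re hℓ] at h3 h4
  rw [Complex.conj_re] at h4
  calc _ ≤ ‖tail y₀ (conj z)‖ + 2 * rate ℓ * (|Real.cos (2 * rate ℓ * z.im)| /
          (‖Complex.cosh (arg ℓ y₀ z)‖ * ‖Complex.sinh (arg ℓ y₀ (conj z))‖)) := by
        refine (norm_sub_le _ _).trans (le_of_eq ?_)
        rw [norm_mul, norm_mul, norm_div, norm_mul, Complex.norm_real, Complex.norm_real]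
        simp [abs_of_pos hc]
    _ ≤ 2 / |z.re| + 2 * rate ℓ * (1 / ((rate ℓ * |z.re|) * (rate ℓ * 1))) := by
        gcongr
        · exact norm_tail_le h
        · exact Real.abs_cos_le_one _
        · refine le_trans ?_ h4
          gcongr
    _ = (2 + 2 / rate ℓ) / |z.re| := by field_simp

theorem continuousOn_tail (hy : |y₀| < ℓ / 2) :
    ContinuousOn (fun z => tail y₀ (conj z)) (strip ℓ)ᶜ :=
  continuousOn_const.div (by fun_prop) fun _ hz => conj_add_ne_zero hy hz

theorem continuousOn_tail₁ (hy : |y₀| < ℓ / 2) :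
    ContinuousOn (fun z => tail₁ y₀ (conj z)) (strip ℓ)ᶜ :=
  continuousOn_const.div (by fun_prop) fun _ hz => pow_ne_zero 2 (conj_add_ne_zero hy hz)

theorem continuousOn_tail₂ (hy : |y₀| < ℓ / 2) :
    ContinuousOn (fun z => tail₂ y₀ (conj z)) (strip ℓ)ᶜ :=
  continuousOn_const.div (by fun_prop) fun _ hz => pow_ne_zero 3 (conj_add_ne_zero hy hz)

theorem continuous_extremal (hℓ : 0 < ℓ) (hy : |y₀| < ℓ / 2) : Continuous (extremal ℓ y₀) :=
  continuous_glue (continuousOn_inner hℓ hy) (continuousOn_tail hy)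
    fun _ hz => hol_add_anti_boundary hℓ hy hz

theorem continuous_dHol_add_dAnti (hℓ : 0 < ℓ) (hy : |y₀| < ℓ / 2) :
    Continuous (fun z => dHol ℓ y₀ z + dAnti ℓ y₀ z) := by
  have h := continuous_glue (continuousOn_inner₁ hℓ hy) (continuousOn_tail₁ hy)
    fun _ hz => hol₁_add_anti₁_boundary hℓ hy hz
  convert h using 1
  ext z
  rw [dHol, dAnti, ← glue_add]
  simp

theorem measurable_dHol (hℓ : 0 < ℓ) (hy : |y₀| < ℓ / 2) : Measurable (dHol ℓ y₀) :=
  measurable_glue (fun _ hz => ((hasDerivAt_hol₁ hℓ (closedStrip_subset_wideStrip hy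
    (strip_subset_closedStrip ℓ hz))).continuousAt).continuousWithinAt) continuousOn_const

theorem measurable_ddHol (hℓ : 0 < ℓ) (hy : |y₀| < ℓ / 2) : Measurable (ddHol ℓ y₀) :=
  measurable_glue ((continuousOn_hol₂ hℓ).mono
    ((strip_subset_closedStrip ℓ).trans (closedStrip_subset_wideStrip hy))) continuousOn_const

theorem measurable_dAnti (hℓ : 0 < ℓ) (hy : |y₀| < ℓ / 2) : Measurable (dAnti ℓ y₀) :=
  measurable_glue ((continuousOn_comp_conj hy fun _ hz =>
    ((hasDerivAt_anti₁ hℓ hz).continuousAt).continuousWithinAt).mono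
      (strip_subset_closedStrip ℓ)) (continuousOn_tail₁ hy)

theorem measurable_ddAnti (hℓ : 0 < ℓ) (hy : |y₀| < ℓ / 2) : Measurable (ddAnti ℓ y₀) :=
  measurable_glue ((continuousOn_comp_conj hy (continuousOn_anti₂ hℓ)).mono
      (strip_subset_closedStrip ℓ)) (continuousOn_tail₂ hy)

/-- The ordinates of the two boundary lines. -/
def boundaryIm (ℓ : ℝ) : Set ℝ := {ℓ / 2, -(ℓ / 2)}

theorem countable_boundaryIm (ℓ : ℝ) : (boundaryIm ℓ).Countable := by
  unfold boundaryIm; exact (Set.toFinite _).countable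

theorem strip_subset_wideStrip (hy : |y₀| < ℓ / 2) : strip ℓ ⊆ wideStrip ℓ y₀ :=
  (strip_subset_closedStrip ℓ).trans (closedStrip_subset_wideStrip hy)

theorem hasDerivAt_extremal_re (hℓ : 0 < ℓ) (hy : |y₀| < ℓ / 2) {z : ℂ}
    (hz : z.im ∉ boundaryIm ℓ) :
    HasDerivAt (fun x : ℝ => extremal ℓ y₀ ⟨x, z.im⟩) (dHol ℓ y₀ z + dAnti ℓ y₀ z) z.re := by
  rw [dHol, dAnti, ← glue_add]
  refine hasDerivAt_glue_comp (γ := fun x : ℝ => (⟨x, z.im⟩ : ℂ)) (hasDerivAt_mk_re z) hz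
    (fun h => ?_) fun h => ?_
  · exact (hasDerivAt_re_of_holomorphic (hasDerivAt_hol hℓ (strip_subset_wideStrip hy h))).add
      (hasDerivAt_re_of_antiholomorphic
        (hasDerivAt_anti hℓ (conj_mem_wideStrip (strip_subset_wideStrip hy h))))
  · simpa using! hasDerivAt_re_of_antiholomorphic (hasDerivAt_tail (conj_add_ne_zero hy h))

theorem hasDerivAt_extremal_im (hℓ : 0 < ℓ) (hy : |y₀| < ℓ / 2) {z : ℂ}
    (hz : z.im ∉ boundaryIm ℓ) :
    HasDerivAt (fun y : ℝ => extremal ℓ y₀ ⟨z.re, y⟩)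
      (Complex.I * (dHol ℓ y₀ z - dAnti ℓ y₀ z)) z.im := by
  have e : Complex.I * (dHol ℓ y₀ z - dAnti ℓ y₀ z) =
      glue ℓ (fun z => Complex.I * hol₁ ℓ y₀ z + -Complex.I * anti₁ ℓ y₀ (conj z))
        (fun z => -Complex.I * tail₁ y₀ (conj z)) z := by
    by_cases h : z ∈ strip ℓ
    · simp only [dHol, dAnti, glue_of_mem h]; ring
    · simp only [dHol, dAnti, glue_of_notMem h]; ring
  rw [e]
  refine hasDerivAt_glue_comp (γ := fun y : ℝ => (⟨z.re, y⟩ : ℂ)) (hasDerivAt_mk_im z) hz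
    (fun h => ?_) fun h => ?_
  · exact (hasDerivAt_im_of_holomorphic (hasDerivAt_hol hℓ (strip_subset_wideStrip hy h))).add
      (hasDerivAt_im_of_antiholomorphic
        (hasDerivAt_anti hℓ (conj_mem_wideStrip (strip_subset_wideStrip hy h))))
  · exact hasDerivAt_im_of_antiholomorphic (hasDerivAt_tail (conj_add_ne_zero hy h))

theorem hasDerivAt_dHol_re (hℓ : 0 < ℓ) (hy : |y₀| < ℓ / 2) {z : ℂ} (hz : z.im ∉ boundaryIm ℓ) :
    HasDerivAt (fun x : ℝ => dHol ℓ y₀ ⟨x, z.im⟩) (ddHol ℓ y₀ z) z.re :=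
  hasDerivAt_glue_comp (γ := fun x : ℝ => (⟨x, z.im⟩ : ℂ)) (hasDerivAt_mk_re z) hz
    (fun h => hasDerivAt_re_of_holomorphic (hasDerivAt_hol₁ hℓ (strip_subset_wideStrip hy h)))
    fun _ => hasDerivAt_const _ _

theorem hasDerivAt_dAnti_re (hℓ : 0 < ℓ) (hy : |y₀| < ℓ / 2) {z : ℂ}
    (hz : z.im ∉ boundaryIm ℓ) :
    HasDerivAt (fun x : ℝ => dAnti ℓ y₀ ⟨x, z.im⟩) (ddAnti ℓ y₀ z) z.re :=
  hasDerivAt_glue_comp (γ := fun x : ℝ => (⟨x, z.im⟩ : ℂ)) (hasDerivAt_mk_re z) hz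
    (F := fun z => anti₁ ℓ y₀ (conj z)) (H := fun z => tail₁ y₀ (conj z))
    (fun h => hasDerivAt_re_of_antiholomorphic (hasDerivAt_anti₁ hℓ
      (conj_mem_wideStrip (strip_subset_wideStrip hy h))))
    fun h => hasDerivAt_re_of_antiholomorphic (hasDerivAt_tail₁ (conj_add_ne_zero hy h))

theorem hasDerivAt_dHol_im (hℓ : 0 < ℓ) (hy : |y₀| < ℓ / 2) {z : ℂ} (hz : z.im ∉ boundaryIm ℓ) :
    HasDerivAt (fun y : ℝ => dHol ℓ y₀ ⟨z.re, y⟩) (Complex.I * ddHol ℓ y₀ z) z.im := by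
  have e : Complex.I * ddHol ℓ y₀ z =
      glue ℓ (fun z => Complex.I * hol₂ ℓ y₀ z) (fun _ => 0) z := by
    by_cases h : z ∈ strip ℓ
    · simp only [ddHol, glue_of_mem h]
    · simp only [ddHol, glue_of_notMem h, mul_zero]
  rw [e]
  exact hasDerivAt_glue_comp (γ := fun y : ℝ => (⟨z.re, y⟩ : ℂ)) (hasDerivAt_mk_im z) hz
    (fun h => hasDerivAt_im_of_holomorphic (hasDerivAt_hol₁ hℓ (strip_subset_wideStrip hy h)))
    fun _ => hasDerivAt_const _ _

theorem hasDerivAt_dAnti_im (hℓ : 0 < ℓ) (hy : |y₀| < ℓ / 2) {z : ℂ}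
    (hz : z.im ∉ boundaryIm ℓ) :
    HasDerivAt (fun y : ℝ => dAnti ℓ y₀ ⟨z.re, y⟩) (-Complex.I * ddAnti ℓ y₀ z) z.im := by
  have e : -Complex.I * ddAnti ℓ y₀ z = glue ℓ (fun z => -Complex.I * anti₂ ℓ y₀ (conj z))
      (fun z => -Complex.I * tail₂ y₀ (conj z)) z := by
    by_cases h : z ∈ strip ℓ
    · simp only [ddAnti, glue_of_mem h]
    · simp only [ddAnti, glue_of_notMem h]
  rw [e]
  exact hasDerivAt_glue_comp (γ := fun y : ℝ => (⟨z.re, y⟩ : ℂ)) (hasDerivAt_mk_im z) hz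
    (F := fun z => anti₁ ℓ y₀ (conj z)) (H := fun z => tail₁ y₀ (conj z))
    (fun h => hasDerivAt_im_of_antiholomorphic (hasDerivAt_anti₁ hℓ
      (conj_mem_wideStrip (strip_subset_wideStrip hy h))))
    fun h => hasDerivAt_im_of_antiholomorphic (hasDerivAt_tail₁ (conj_add_ne_zero hy h))

/-- The partial derivative of the extremal map in the real direction. -/
def extremalX (ℓ y₀ : ℝ) (z : ℂ) : ℂ := dHol ℓ y₀ z + dAnti ℓ y₀ z

/-- The partial derivative of the extremal map in the imaginary direction. -/
def extremalY (ℓ y₀ : ℝ) (z : ℂ) : ℂ := Complex.I * (dHol ℓ y₀ z - dAnti ℓ y₀ z)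

theorem measurable_extremalX (hℓ : 0 < ℓ) (hy : |y₀| < ℓ / 2) : Measurable (extremalX ℓ y₀) :=
  (measurable_dHol hℓ hy).add (measurable_dAnti hℓ hy)

theorem measurable_extremalY (hℓ : 0 < ℓ) (hy : |y₀| < ℓ / 2) : Measurable (extremalY ℓ y₀) :=
  ((measurable_dHol hℓ hy).sub (measurable_dAnti hℓ hy)).const_mul Complex.I

theorem decays_extremalX (hℓ : 0 < ℓ) (hy : |y₀| < ℓ / 2) : Decays 2 (extremalX ℓ y₀) :=
  (decays_dHol hℓ hy).add (decays_dAnti hℓ hy)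

theorem decays_extremalY (hℓ : 0 < ℓ) (hy : |y₀| < ℓ / 2) : Decays 2 (extremalY ℓ y₀) :=
  ((decays_dHol hℓ hy).sub (decays_dAnti hℓ hy)).const_mul Complex.I

theorem hasWeakGradient_extremal (hℓ : 0 < ℓ) (hy : |y₀| < ℓ / 2) :
    HasWeakGradient (extremal ℓ y₀) (extremalX ℓ y₀) (extremalY ℓ y₀) := by
  obtain ⟨C, hC⟩ := (decays_extremalX hℓ hy).bounded
  obtain ⟨D, hD⟩ := (decays_extremalY hℓ hy).bounded
  exact hasWeakGradient_of_hasDerivAt (countable_boundaryIm ℓ) (continuous_extremal hℓ hy)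
    (measurable_extremalX hℓ hy) (measurable_extremalY hℓ hy) (C := max C D)
    (fun z => (hC z).trans (le_max_left _ _)) (fun z => (hD z).trans (le_max_right _ _))
    (fun z hz => hasDerivAt_extremal_re hℓ hy hz) (fun z hz => hasDerivAt_extremal_im hℓ hy hz)

theorem integrable_sq_dHol (hℓ : 0 < ℓ) (hy : |y₀| < ℓ / 2) :
    Integrable (fun z => conj (dHol ℓ y₀ z) * dHol ℓ y₀ z) :=
  ((decays_dHol hℓ hy).conj.mul (decays_dHol hℓ hy)).integrable (by norm_num)
    ((Complex.continuous_conj.measurable.comp (measurable_dHol hℓ hy)).mul (measurable_dHol hℓ hy))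

theorem integrable_sq_dAnti (hℓ : 0 < ℓ) (hy : |y₀| < ℓ / 2) :
    Integrable (fun z => conj (dAnti ℓ y₀ z) * dAnti ℓ y₀ z) :=
  ((decays_dAnti hℓ hy).conj.mul (decays_dAnti hℓ hy)).integrable (by norm_num)
    ((Complex.continuous_conj.measurable.comp (measurable_dAnti hℓ hy)).mul
      (measurable_dAnti hℓ hy))

/-- The Jacobian of the extremal map has integral zero. -/
theorem integral_sq_dHol_eq (hℓ : 0 < ℓ) (hy : |y₀| < ℓ / 2) :
    ∫ z, conj (dHol ℓ y₀ z) * dHol ℓ y₀ z = ∫ z, conj (dAnti ℓ y₀ z) * dAnti ℓ y₀ z := by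
  set u := extremal ℓ y₀ with hu
  set A := dHol ℓ y₀ with hA
  set B := dAnti ℓ y₀ with hB
  set A' := ddHol ℓ y₀ with hA'
  set B' := ddAnti ℓ y₀ with hB'
  have mu : Measurable u := (continuous_extremal hℓ hy).measurable
  have mA : Measurable A := measurable_dHol hℓ hy
  have mB : Measurable B := measurable_dAnti hℓ hy
  have mA' : Measurable A' := measurable_ddHol hℓ hy
  have mB' : Measurable B' := measurable_ddAnti hℓ hy
  have du : Decays 1 u := decays_extremal hℓ hy
  have dA : Decays 2 A := decays_dHol hℓ hy
  have dB : Decays 2 B := decays_dAnti hℓ hy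
  have dA' : Decays 2 A' := decays_ddHol hℓ hy
  have dB' : Decays 2 B' := decays_ddAnti hℓ hy
  have mconj : Measurable (conj : ℂ → ℂ) := Complex.continuous_conj.measurable
  have i1 : Integrable (fun z => conj (A z + B z) * (A z - B z) + conj (u z) * (A' z - B' z)) :=
    (((dA.add dB).conj.mul (dA.sub dB)).mono (by norm_num : 3 ≤ 2 + 2)).add
      (du.conj.mul (dA'.sub dB')) |>.integrable le_rfl
      (((mconj.comp (mA.add mB)).mul (mA.sub mB)).add ((mconj.comp mu).mul (mA'.sub mB')))
  have i2 : Integrable (fun z => conj (Complex.I * (A z - B z)) * (A z + B z)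
      + conj (u z) * (Complex.I * (A' z - B' z))) :=
    ((((dA.sub dB).const_mul Complex.I).conj.mul (dA.add dB)).mono
      (by norm_num : 3 ≤ 2 + 2)).add
      (du.conj.mul ((dA'.sub dB').const_mul Complex.I)) |>.integrable le_rfl
      (((mconj.comp ((mA.sub mB).const_mul _)).mul (mA.add mB)).add
        ((mconj.comp mu).mul ((mA'.sub mB').const_mul _)))
  have e1 := integral_eq_zero_of_hasDerivAt_re (F := fun z => conj (u z) * (A z - B z))
    (countable_boundaryIm ℓ) i1
    (fun z hz => by
      have h1 := Complex.conjCLE.toContinuousLinearMap.hasFDerivAt.comp_hasDerivAt z.re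
        (hasDerivAt_extremal_re hℓ hy hz)
      exact h1.mul ((hasDerivAt_dHol_re hℓ hy hz).sub (hasDerivAt_dAnti_re hℓ hy hz)))
    ((du.conj.mul (dA.sub dB)).tendsto_zero (by norm_num))
  have e2 := integral_eq_zero_of_hasDerivAt_im (F := fun z => conj (u z) * (A z + B z))
    (countable_boundaryIm ℓ) i2
    ((Complex.continuous_conj.comp (continuous_extremal hℓ hy)).mul
      (continuous_dHol_add_dAnti hℓ hy))
    (fun z hz => by
      have h1 := Complex.conjCLE.toContinuousLinearMap.hasFDerivAt.comp_hasDerivAt z.im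
        (hasDerivAt_extremal_im hℓ hy hz)
      refine (h1.mul ((hasDerivAt_dHol_im hℓ hy hz).add (hasDerivAt_dAnti_im hℓ hy hz))
        ).congr_deriv ?_
      rw [neg_mul, ← sub_eq_add_neg, ← mul_sub]
      rfl)
    ((du.conj.mul (dA.add dB)).tendsto_zero (by norm_num))
  have e3 : ∫ z, ((conj (A z + B z) * (A z - B z) + conj (u z) * (A' z - B' z))
      + Complex.I * (conj (Complex.I * (A z - B z)) * (A z + B z)
      + conj (u z) * (Complex.I * (A' z - B' z)))) = 0 := by
    rw [integral_add i1 (i2.const_mul _), integral_const_mul, e1, e2]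
    simp
  -- The second derivatives cancel since `i² = -1`; twice the Jacobian density remains.
  have e4 : ∀ z, ((conj (A z + B z) * (A z - B z) + conj (u z) * (A' z - B' z))
      + Complex.I * (conj (Complex.I * (A z - B z)) * (A z + B z)
      + conj (u z) * (Complex.I * (A' z - B' z)))) =
      2 * (conj (A z) * A z - conj (B z) * B z) := by
    intro z
    simp only [map_mul, map_add, map_sub, Complex.conj_I]
    linear_combination (conj (u z) * (A' z - B' z)
      - (conj (A z) - conj (B z)) * (A z + B z)) * Complex.I_mul_I
  simp only [e4] at e3
  rw [integral_const_mul, integral_sub (integrable_sq_dHol hℓ hy) (integrable_sq_dAnti hℓ hy)] at e3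
  have := (mul_eq_zero.1 e3).resolve_left two_ne_zero
  exact sub_eq_zero.1 this

end

/-! ### The area of the image of the holomorphic part -/

theorem det_restrictScalars_smulRight (d : ℂ) :
    ((ContinuousLinearMap.toSpanSingleton ℂ d).restrictScalars ℝ).det = ‖d‖ ^ 2 := by
  rw [Complex.sq_norm, ← Algebra.norm_complex_apply, Algebra.norm_apply]
  change LinearMap.det _ = _
  congr 1
  ext z; simp [mul_comm]

theorem tan_sq_add_one {x : ℝ} (h : Real.cos x ≠ 0) :
    1 + Real.tan x ^ 2 = (1 / Real.cos x) ^ 2 := by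
  rw [Real.tan_eq_sin_div_cos]
  field_simp
  linarith [Real.sin_sq_add_cos_sq x]

/-- The disc with centre `i tan 2θ` and radius `1 / cos 2θ` is the Möbius image of a half plane with
the origin on its boundary; in the variable `exp (2 w)` that half plane is
`cos (2 (Im w - θ)) > 0`. -/
theorem tanh_mem_ball_iff {θ : ℝ} (hθ : |2 * θ| < Real.pi / 2) {w : ℂ} (hw : Complex.cosh w ≠ 0) :
    Complex.tanh w ∈ Metric.ball ((Real.tan (2 * θ) : ℂ) * Complex.I) (1 / Real.cos (2 * θ)) ↔
      0 < Real.cos (2 * (w.im - θ)) := by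
  have hc : 0 < Real.cos (2 * θ) := Real.cos_pos_of_mem_Ioo (abs_lt.1 hθ)
  set t := Real.tan (2 * θ) with ht
  have hC : 0 < ‖Complex.cosh w‖ := norm_pos_iff.2 hw
  have e1 : Complex.tanh w - (t : ℂ) * Complex.I =
      (Complex.sinh w - t * Complex.I * Complex.cosh w) / Complex.cosh w := by
    rw [Complex.tanh_eq_sinh_div_cosh]; field_simp
  have e2 : ‖Complex.sinh w - t * Complex.I * Complex.cosh w‖ ^ 2 =
      (1 + t ^ 2) * ‖Complex.cosh w‖ ^ 2
        - (Real.cos (2 * w.im) + t * Real.sin (2 * w.im)) := by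
    rw [Complex.sq_norm, norm_sq_cosh, Complex.normSq_apply, sinh_re_im, cosh_re_im,
      Real.cos_two_mul, Real.sin_two_mul]
    have h1 := Real.cosh_sq w.re
    have h2 := Real.sin_sq_add_cos_sq w.im
    simp
    linear_combination (Real.sin w.im - t * Real.cos w.im) ^ 2 * h1
      + (Real.sinh w.re ^ 2 * (1 + t ^ 2) + 1) * h2
  have e3 : Real.cos (2 * (w.im - θ)) =
      Real.cos (2 * θ) * (Real.cos (2 * w.im) + t * Real.sin (2 * w.im)) := by
    rw [mul_sub, Real.cos_sub, ht, Real.tan_eq_sin_div_cos]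
    field_simp
  rw [mem_ball_iff_norm, e1, norm_div, div_lt_iff₀ hC,
    ← pow_lt_pow_iff_left₀ (norm_nonneg _) (by positivity) two_ne_zero, e2, mul_pow,
    ← tan_sq_add_one hc.ne', e3, mul_pos_iff_of_pos_left hc]
  constructor <;> intro h <;> linarith

theorem tanh_image {θ : ℝ} (hθ : |2 * θ| < Real.pi / 2) :
    Complex.tanh '' {w | |w.im - θ| < Real.pi / 4 ∧ Complex.cosh w ≠ 0} =
      Metric.ball ((Real.tan (2 * θ) : ℂ) * Complex.I) (1 / Real.cos (2 * θ)) := by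
  have hc : 0 < Real.cos (2 * θ) := Real.cos_pos_of_mem_Ioo (abs_lt.1 hθ)
  apply Subset.antisymm
  · rintro _ ⟨w, ⟨hw, hw'⟩, rfl⟩
    rw [tanh_mem_ball_iff hθ hw']
    apply Real.cos_pos_of_mem_Ioo
    rw [abs_lt] at hw
    constructor <;> linarith
  · intro τ hτ
    have hne : ∀ e : ℝ, e ^ 2 = 1 → τ ≠ (e : ℂ) := by
      rintro e he rfl
      rw [mem_ball_iff_norm, ← pow_lt_pow_iff_left₀ (norm_nonneg _) (by positivity) two_ne_zero,
        ← tan_sq_add_one hc.ne', Complex.sq_norm, Complex.normSq_apply] at hτ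
      simp only [Complex.sub_re, Complex.sub_im, Complex.mul_re, Complex.mul_im, Complex.ofReal_re,
        Complex.ofReal_im, Complex.I_re, Complex.I_im] at hτ
      nlinarith
    have h1 : (1 : ℂ) - τ ≠ 0 := fun h => hne 1 (by norm_num) (by
      rw [Complex.ofReal_one]; exact (sub_eq_zero.1 h).symm)
    have h2 : (1 : ℂ) + τ ≠ 0 := fun h => hne (-1) (by norm_num) (by
      push_cast; linear_combination h)
    -- `exp (2 w)` must be `(1 + τ) / (1 - τ)`; the rotation by `2θ` selects the branch of the
    -- logarithm for which `Im w` lies in the given strip.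
    set ζ := (1 + τ) / (1 - τ) * Complex.exp (-(2 * θ * Complex.I)) with hζ
    have hζ0 : ζ ≠ 0 := mul_ne_zero (div_ne_zero h2 h1) (Complex.exp_ne_zero _)
    set w := Complex.log ζ / 2 + θ * Complex.I with hw
    have hexp : Complex.exp (2 * w) = (1 + τ) / (1 - τ) := by
      rw [hw, mul_add, mul_div_cancel₀ _ (two_ne_zero), Complex.exp_add, Complex.exp_log hζ0, hζ,
        mul_assoc, ← Complex.exp_add]
      ring_nf; simp
    have hexp' : Complex.exp w * Complex.exp w = (1 + τ) / (1 - τ) := by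
      rw [← Complex.exp_add, ← two_mul, hexp]
    have hm : Complex.exp w * Complex.exp (-w) = 1 := by rw [← Complex.exp_add]; simp
    have hE : Complex.exp w ≠ 0 := Complex.exp_ne_zero w
    have hcosh : Complex.cosh w ≠ 0 := by
      intro h
      have h3 := Complex.two_cosh w
      rw [h, mul_zero] at h3
      have h4 : (1 + τ) / (1 - τ) + 1 = 0 := by
        rw [← hexp', ← hm, ← mul_add, ← h3, mul_zero]
      field_simp at h4
      norm_num at h4
    have htanh : Complex.tanh w = τ := by
      rw [Complex.tanh_eq_sinh_div_cosh, div_eq_iff hcosh]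
      have h3 := Complex.two_cosh w
      have h4 := Complex.two_sinh w
      have h5 : Complex.exp w * (Complex.exp w * (1 - τ)) = 1 + τ := by
        rw [← mul_assoc, hexp']; field_simp
      have h6 : Complex.exp w * (2 * Complex.sinh w - τ * (2 * Complex.cosh w)) = 0 := by
        rw [h3, h4]; linear_combination h5 - (1 + τ) * hm
      have h7 := (mul_eq_zero.1 h6).resolve_left hE
      linear_combination h7 / 2
    refine ⟨w, ⟨?_, hcosh⟩, htanh⟩
    have h3 := (tanh_mem_ball_iff hθ hcosh).1 (by rwa [htanh])
    have h4 : 2 * (w.im - θ) = ζ.arg := by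
      rw [hw]; simp [Complex.log_im]; ring
    rw [h4] at h3
    have h5 : |ζ.arg| < Real.pi / 2 := by
      by_contra h
      rw [not_lt] at h
      rw [← Real.cos_abs] at h3
      exact absurd h3 (not_lt.2 (Real.cos_nonpos_of_pi_div_two_le_of_le h
        ((Complex.abs_arg_le_pi ζ).trans (by linarith [Real.pi_pos]))))
    rw [← h4, abs_mul, abs_two] at h5
    linarith

theorem tanh_injOn {w w' : ℂ} (hw : Complex.cosh w ≠ 0) (hw' : Complex.cosh w' ≠ 0)
    (h : |(w - w').im| < Real.pi) (he : Complex.tanh w = Complex.tanh w') : w = w' := by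
  by_contra hne
  apply sinh_ne_zero_of_abs_im_lt h (sub_ne_zero.2 hne)
  rw [Complex.tanh_eq_sinh_div_cosh, Complex.tanh_eq_sinh_div_cosh, div_eq_div_iff hw hw'] at he
  rw [Complex.sinh_sub]
  linear_combination he

section

variable {ℓ y₀ : ℝ}

theorem arg_im (ℓ y₀ : ℝ) (z : ℂ) : (arg ℓ y₀ z).im = rate ℓ * (z.im + y₀) := by simp [arg]

theorem mem_strip_iff_arg (hℓ : 0 < ℓ) {z : ℂ} :
    z ∈ strip ℓ ↔ |(arg ℓ y₀ z).im - rate ℓ * y₀| < Real.pi / 4 := by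
  have hc := rate_pos hℓ
  rw [arg_im, mem_strip, show rate ℓ * (z.im + y₀) - rate ℓ * y₀ = rate ℓ * z.im by ring, abs_mul,
    abs_of_pos hc, show Real.pi / 4 = rate ℓ * (ℓ / 2) by linarith [rate_mul hℓ],
    mul_lt_mul_iff_right₀ hc]

theorem two_rate_mul (ℓ y₀ : ℝ) : 2 * (rate ℓ * y₀) = Real.pi * y₀ / ℓ := by
  unfold rate
  rcases eq_or_ne ℓ 0 with rfl | h
  · simp
  · field_simp

theorem abs_two_rate_mul_lt (hℓ : 0 < ℓ) (hy : |y₀| < ℓ / 2) :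
    |2 * (rate ℓ * y₀)| < Real.pi / 2 := by
  have hc := rate_pos hℓ
  rw [abs_mul, abs_mul, abs_of_pos hc, abs_two, ← rate_mul hℓ]
  nlinarith

open scoped Pointwise in
theorem hol_image_strip (hℓ : 0 < ℓ) (hy : |y₀| < ℓ / 2) :
    hol ℓ y₀ '' strip ℓ = (2 * rate ℓ) •
      Metric.ball ((Real.tan (2 * (rate ℓ * y₀)) : ℂ) * Complex.I)
        (1 / Real.cos (2 * (rate ℓ * y₀))) := by
  have hc : (rate ℓ : ℂ) ≠ 0 := by exact_mod_cast (rate_pos hℓ).ne'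
  rw [← tanh_image (abs_two_rate_mul_lt hℓ hy)]
  ext τ
  simp only [mem_image, mem_smul_set, mem_ofPred_eq]
  constructor
  · rintro ⟨z, hz, rfl⟩
    refine ⟨_, ⟨arg ℓ y₀ z, ⟨(mem_strip_iff_arg hℓ).1 hz,
      cosh_arg_ne_zero hℓ (strip_subset_wideStrip hy hz)⟩, rfl⟩, ?_⟩
    simp [hol]
  · rintro ⟨_, ⟨w, ⟨hw, _⟩, rfl⟩, rfl⟩
    have e : arg ℓ y₀ (w / rate ℓ - Complex.I * y₀) = w := by
      rw [arg]; field_simp; ring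
    refine ⟨w / rate ℓ - Complex.I * y₀, (mem_strip_iff_arg (y₀ := y₀) hℓ).2 (by rwa [e]), ?_⟩
    simp [hol, e]

theorem hol_injOn_strip (hℓ : 0 < ℓ) (hy : |y₀| < ℓ / 2) : InjOn (hol ℓ y₀) (strip ℓ) := by
  intro z hz z' hz' h
  have hc : (rate ℓ : ℂ) ≠ 0 := by exact_mod_cast (rate_pos hℓ).ne'
  have h1 : Complex.tanh (arg ℓ y₀ z) = Complex.tanh (arg ℓ y₀ z') :=
    mul_left_cancel₀ (mul_ne_zero two_ne_zero hc) h
  have h2 := tanh_injOn (cosh_arg_ne_zero hℓ (strip_subset_wideStrip hy hz))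
    (cosh_arg_ne_zero hℓ (strip_subset_wideStrip hy hz')) (by
      have a := abs_lt.1 ((mem_strip_iff_arg (y₀ := y₀) hℓ).1 hz)
      have b := abs_lt.1 ((mem_strip_iff_arg (y₀ := y₀) hℓ).1 hz')
      rw [Complex.sub_im, abs_lt]
      constructor <;> linarith [Real.pi_pos]) h1
  exact add_right_cancel (mul_left_cancel₀ hc h2)

/-- The area formula for the injective map `hol`, whose Jacobian determinant is `|hol₁|²`. -/
theorem lintegral_sq_hol₁ (hℓ : 0 < ℓ) (hy : |y₀| < ℓ / 2) :
    ∫⁻ z in strip ℓ, ENNReal.ofReal (‖hol₁ ℓ y₀ z‖ ^ 2) =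
      ENNReal.ofReal (Real.pi ^ 3 / (ℓ ^ 2 * Real.cos (Real.pi * y₀ / ℓ) ^ 2)) := by
  have h := lintegral_abs_det_fderiv_eq_addHaar_image (volume : Measure ℂ)
    (isOpen_strip ℓ).measurableSet
    (f' := fun z => (ContinuousLinearMap.toSpanSingleton ℂ (hol₁ ℓ y₀ z)).restrictScalars ℝ)
    (f := hol ℓ y₀) (fun z hz => ((hasDerivAt_hol hℓ (strip_subset_wideStrip hy
      hz)).hasFDerivAt.restrictScalars ℝ).hasFDerivWithinAt) (hol_injOn_strip hℓ hy)
  simp only [det_restrictScalars_smulRight, abs_of_nonneg (sq_nonneg ‖_‖)] at h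
  have hc : 0 < Real.cos (2 * (rate ℓ * y₀)) :=
    Real.cos_pos_of_mem_Ioo (abs_lt.1 (abs_two_rate_mul_lt hℓ hy))
  have hr := rate_pos hℓ
  rw [h, hol_image_strip hℓ hy, Measure.addHaar_smul, Complex.volume_ball,
    Complex.finrank_real_complex, ← ENNReal.ofReal_coe_nnreal, ← ENNReal.ofReal_pow (by positivity),
    ← ENNReal.ofReal_mul (by positivity), ← ENNReal.ofReal_mul (by positivity),
    two_rate_mul, abs_of_nonneg (by positivity)]
  congr 1
  rw [two_rate_mul] at hc
  rw [rate]
  simp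
  field_simp

end

/-! ### Orthogonality of the extremal map to admissible variations -/

theorem HasWeakGradient.integral_conj_fderiv_mul_comm {u gx gy : ℂ → ℂ}
    (hu : HasWeakGradient u gx gy) {Φ : ℂ → ℂ} (hΦ : ContDiff ℝ ∞ Φ) (hc : HasCompactSupport Φ) :
    ∫ z, conj (fderiv ℝ Φ z Complex.I) * gx z = ∫ z, conj (fderiv ℝ Φ z 1) * gy z := by
  have hd : ∀ z, HasFDerivAt Φ (fderiv ℝ Φ z) z :=
    fun z => (hΦ.differentiable (by simp) z).hasFDerivAt
  have ha : ContDiff ℝ ∞ (fun z => (Φ z).re) := Complex.reCLM.contDiff.comp hΦ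
  have hb : ContDiff ℝ ∞ (fun z => (Φ z).im) := Complex.imCLM.contDiff.comp hΦ
  have hac : HasCompactSupport (fun z => (Φ z).re) := hc.comp_left (g := Complex.re) rfl
  have hbc : HasCompactSupport (fun z => (Φ z).im) := hc.comp_left (g := Complex.im) rfl
  have ea : ∀ z v, fderiv ℝ (fun z => (Φ z).re) z v = (fderiv ℝ Φ z v).re := fun z v => by
    exact congrArg (fun L : ℂ →L[ℝ] ℝ => L v) (Complex.reCLM.hasFDerivAt.comp z (hd z)).fderiv
  have eb : ∀ z v, fderiv ℝ (fun z => (Φ z).im) z v = (fderiv ℝ Φ z v).im := fun z v => by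
    exact congrArg (fun L : ℂ →L[ℝ] ℝ => L v) (Complex.imCLM.hasFDerivAt.comp z (hd z)).fderiv
  have split : ∀ (v : ℂ) (g : ℂ → ℂ), LocallyL2 g → ∫ z, conj (fderiv ℝ Φ z v) * g z =
      (∫ z, fderiv ℝ (fun z => (Φ z).re) z v • g z)
        - Complex.I * ∫ z, fderiv ℝ (fun z => (Φ z).im) z v • g z := by
    intro v g hg
    have i1 := hg.integrable_smul (continuous_fderiv_apply ha v)
      (hasCompactSupport_fderiv_apply hac v)
    have i2 := hg.integrable_smul (continuous_fderiv_apply hb v)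
      (hasCompactSupport_fderiv_apply hbc v)
    rw [← integral_const_mul, ← integral_sub i1 (i2.const_mul _)]
    congr 1 with z
    rw [ea, eb, Complex.real_smul, Complex.real_smul]
    nth_rw 1 [← Complex.re_add_im (fderiv ℝ Φ z v)]
    simp only [map_add, map_mul, Complex.conj_ofReal, Complex.conj_I]
    ring
  rw [split _ _ hu.gx_l2, split _ _ hu.gy_l2, hu.integral_fderiv_smul_comm ha hac,
    hu.integral_fderiv_smul_comm hb hbc]

theorem ae_im_notMem_boundaryIm (ℓ : ℝ) : ∀ᵐ z : ℂ, z.im ∉ boundaryIm ℓ := by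
  rw [ae_iff]
  have h : {z : ℂ | ¬z.im ∉ boundaryIm ℓ} =
      Complex.measurableEquivRealProd ⁻¹' (univ ×ˢ boundaryIm ℓ) := by
    ext z; simp [Complex.measurableEquivRealProd_apply]
  rw [h, Complex.volume_preserving_equiv_real_prod.measure_preimage_equiv,
    Measure.volume_eq_prod, Measure.prod_prod, (countable_boundaryIm ℓ).measure_zero, mul_zero]

/-- The boundary of the strip is null, so the weak gradient of a function that vanishes outside
the strip vanishes there too. -/
theorem HasWeakGradient.ae_eq_zero_off_strip {w wx wy : ℂ → ℂ} {ℓ : ℝ}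
    (hw : HasWeakGradient w wx wy) (h0 : ∀ᵐ z : ℂ, z ∉ strip ℓ → w z = 0) :
    (∀ᵐ z : ℂ, z ∉ strip ℓ → wx z = 0) ∧ ∀ᵐ z : ℂ, z ∉ strip ℓ → wy z = 0 := by
  have h := hw.ae_eq_zero_of_ae_eq_zero (isClosed_closedStrip ℓ).isOpen_compl
    (h0.mono fun z hz hz' => hz fun h => hz' (strip_subset_closedStrip ℓ h))
  have key : ∀ z : ℂ, z.im ∉ boundaryIm ℓ → z ∉ strip ℓ → z ∈ (closedStrip ℓ)ᶜ := by
    intro z hb hz h2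
    have h3 : |z.im| = ℓ / 2 := le_antisymm h2 (not_lt.1 fun h' => hz (mem_strip.2 h'))
    rcases abs_choice z.im with h4 | h4 <;> rw [h4] at h3
    · exact hb (by simp [boundaryIm, h3])
    · exact hb (by simp [boundaryIm, ← h3])
  constructor
  · filter_upwards [h.1, ae_im_notMem_boundaryIm ℓ] with z h1 h2 h3 using h1 (key z h2 h3)
  · filter_upwards [h.2, ae_im_notMem_boundaryIm ℓ] with z h1 h2 h3 using h1 (key z h2 h3)

theorem Decays.memLp_two {f : ℂ → ℂ} (hf : Decays 2 f) (hm : Measurable f) : MemLp f 2 := by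
  rw [memLp_two_iff_integrable_sq_norm hm.aestronglyMeasurable]
  refine ((hf.mul hf).integrable (by norm_num) (hm.mul hm)).norm.congr (Eventually.of_forall ?_)
  intro z
  simp [sq]

section

variable {ℓ y₀ : ℝ}

/-- The harmonic conjugate of the inner formula. -/
def harmConj (ℓ y₀ : ℝ) (z : ℂ) : ℂ :=
  -Complex.I * hol ℓ y₀ z + Complex.I * anti ℓ y₀ (conj z)

/-- First half of the Cauchy-Riemann equations for the harmonic conjugate. -/
theorem hasDerivAt_harmConj_re (hℓ : 0 < ℓ) (hy : |y₀| < ℓ / 2) {z : ℂ} (hz : z ∈ strip ℓ) :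
    HasDerivAt (fun x : ℝ => harmConj ℓ y₀ ⟨x, z.im⟩) (-extremalY ℓ y₀ z) z.re := by
  have hw := strip_subset_wideStrip hy hz
  refine (((hasDerivAt_re_of_holomorphic (hasDerivAt_hol hℓ hw)).const_mul (-Complex.I)).add
    ((hasDerivAt_re_of_antiholomorphic (hasDerivAt_anti hℓ (conj_mem_wideStrip hw))).const_mul
      Complex.I)).congr_deriv ?_
  simp only [extremalY, dHol, dAnti, glue_of_mem hz]
  ring

/-- Second half of the Cauchy-Riemann equations for the harmonic conjugate. -/
theorem hasDerivAt_harmConj_im (hℓ : 0 < ℓ) (hy : |y₀| < ℓ / 2) {z : ℂ} (hz : z ∈ strip ℓ) :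
    HasDerivAt (fun y : ℝ => harmConj ℓ y₀ ⟨z.re, y⟩) (extremalX ℓ y₀ z) z.im := by
  have hw := strip_subset_wideStrip hy hz
  refine (((hasDerivAt_im_of_holomorphic (hasDerivAt_hol hℓ hw)).const_mul (-Complex.I)).add
    ((hasDerivAt_im_of_antiholomorphic (hasDerivAt_anti hℓ (conj_mem_wideStrip hw))).const_mul
      Complex.I)).congr_deriv ?_
  simp only [extremalX, dHol, dAnti, glue_of_mem hz]
  linear_combination -(hol₁ ℓ y₀ z + anti₁ ℓ y₀ (conj z)) * Complex.I_mul_I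

theorem contDiffOn_harmConj (hℓ : 0 < ℓ) :
    ContDiffOn ℝ ∞ (harmConj ℓ y₀) (wideStrip ℓ y₀) := by
  have h1 : ContDiffOn ℝ ∞ (hol ℓ y₀) (wideStrip ℓ y₀) :=
    (DifferentiableOn.contDiffOn (fun z hz =>
      (hasDerivAt_hol hℓ hz).differentiableAt.differentiableWithinAt)
      (isOpen_wideStrip ℓ y₀)).restrict_scalars ℝ
  have h2 : ContDiffOn ℝ ∞ (anti ℓ y₀) (wideStrip ℓ y₀) :=
    (DifferentiableOn.contDiffOn (fun z hz =>
      (hasDerivAt_anti hℓ hz).differentiableAt.differentiableWithinAt)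
      (isOpen_wideStrip ℓ y₀)).restrict_scalars ℝ
  exact (contDiffOn_const.mul h1).add (contDiffOn_const.mul
    (h2.comp Complex.conjCLE.contDiff.contDiffOn fun z hz => conj_mem_wideStrip hz))

theorem exists_bound_harmConj (hℓ : 0 < ℓ) (hy : |y₀| < ℓ / 2) :
    ∃ D, ∀ z ∈ strip ℓ, ‖harmConj ℓ y₀ z‖ ≤ D := by
  have hc := rate_pos hℓ
  obtain ⟨C, hC⟩ := exists_bound_of_continuousOn_closedStrip hℓ (F := hol ℓ y₀) (k := 0)
    (C := 2 * rate ℓ * (1 / rate ℓ + 1))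
    (fun z hz => ((hasDerivAt_hol hℓ
      (closedStrip_subset_wideStrip hy hz)).continuousAt).continuousWithinAt) (fun z hz h => by
      have h3 : rate ℓ ≤ |(arg ℓ y₀ z).re| := by
        rw [abs_arg_re hℓ]; nlinarith
      rw [hol, norm_mul, Complex.tanh_eq_sinh_div_cosh, pow_zero, div_one, norm_mul,
        Complex.norm_ofNat, Complex.norm_real, Real.norm_of_nonneg hc.le]
      gcongr
      exact norm_sinh_div_cosh_le hc h3)
  obtain ⟨E, hE⟩ := (decays_extremal hℓ hy).bounded
  refine ⟨C + (E + C), fun z hz => ?_⟩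
  have h1 : ‖hol ℓ y₀ z‖ ≤ C := by simpa using hC z (strip_subset_closedStrip ℓ hz)
  have h2 : anti ℓ y₀ (conj z) = extremal ℓ y₀ z - hol ℓ y₀ z := by
    rw [extremal, glue_of_mem hz]; ring
  have h3 : ‖anti ℓ y₀ (conj z)‖ ≤ E + C := by
    rw [h2]; exact (norm_sub_le _ _).trans (add_le_add (hE z) h1)
  refine (norm_add_le _ _).trans ?_
  rw [norm_mul, norm_mul, norm_neg, Complex.norm_I, one_mul, one_mul]
  exact add_le_add h1 h3

/-- The cutoff in the real direction, equal to `1` for `|x| ≤ 1` and to `0` for `|x| ≥ 2`. -/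
def cutoffRe : ContDiffBump (0 : ℝ) := ⟨1, 2, by norm_num, by norm_num⟩

/-- A cutoff in the imaginary direction, equal to `1` in the strip, with support in
`wideStrip`. -/
def cutoffIm (hℓ : 0 < ℓ) (hy : |y₀| < ℓ / 2) : ContDiffBump (0 : ℝ) :=
  ⟨ℓ / 2, (ℓ / 2 + (ℓ - |y₀|)) / 2, by linarith, by linarith⟩

/-- The product of the two cutoffs, the first rescaled to length `n + 1`. -/
def cutoff (hℓ : 0 < ℓ) (hy : |y₀| < ℓ / 2) (n : ℕ) (z : ℂ) : ℝ :=
  cutoffRe (z.re / (n + 1)) * cutoffIm hℓ hy z.im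

theorem contDiff_cutoff (hℓ : 0 < ℓ) (hy : |y₀| < ℓ / 2) (n : ℕ) :
    ContDiff ℝ ∞ (cutoff hℓ hy n) :=
  (cutoffRe.contDiff.comp (Complex.reCLM.contDiff.div_const _)).mul
    ((cutoffIm hℓ hy).contDiff.comp Complex.imCLM.contDiff)

theorem support_cutoff_subset (hℓ : 0 < ℓ) (hy : |y₀| < ℓ / 2) (n : ℕ) :
    Function.support (cutoff hℓ hy n) ⊆ Icc (-(2 * (n + 1) : ℝ)) (2 * (n + 1)) ×ℂ
      Icc (-((ℓ / 2 + (ℓ - |y₀|)) / 2)) ((ℓ / 2 + (ℓ - |y₀|)) / 2) := by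
  intro z hz
  have hn : (0 : ℝ) < n + 1 := by positivity
  have h1 : z.re / (n + 1) ∈ Function.support cutoffRe := fun h => hz (by simp [cutoff, h])
  have h2 : z.im ∈ Function.support (cutoffIm hℓ hy) := fun h => hz (by simp [cutoff, h])
  rw [ContDiffBump.support_eq, mem_ball_zero_iff, Real.norm_eq_abs] at h1 h2
  rw [abs_div, abs_of_pos hn, div_lt_iff₀ hn] at h1
  exact ⟨abs_le.1 h1.le, abs_le.1 h2.le⟩

theorem tsupport_cutoff_subset (hℓ : 0 < ℓ) (hy : |y₀| < ℓ / 2) (n : ℕ) :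
    tsupport (cutoff hℓ hy n) ⊆ wideStrip ℓ y₀ := by
  have h : IsClosed {z : ℂ | |z.im| ≤ (ℓ / 2 + (ℓ - |y₀|)) / 2} :=
    isClosed_le (by fun_prop) continuous_const
  refine (closure_minimal (fun z hz => ?_) h).trans fun z hz => ?_
  · exact abs_le.2 (support_cutoff_subset hℓ hy n hz).2
  · have hz' : |z.im| ≤ (ℓ / 2 + (ℓ - |y₀|)) / 2 := hz
    change |z.im| < _
    linarith

theorem hasCompactSupport_cutoff (hℓ : 0 < ℓ) (hy : |y₀| < ℓ / 2) (n : ℕ) :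
    HasCompactSupport (cutoff hℓ hy n) :=
  HasCompactSupport.of_support_subset_isCompact (isCompact_Icc.reProdIm isCompact_Icc)
    (support_cutoff_subset hℓ hy n)

/-- The test function: the harmonic conjugate, cut off. -/
def testMap (hℓ : 0 < ℓ) (hy : |y₀| < ℓ / 2) (n : ℕ) (z : ℂ) : ℂ :=
  cutoff hℓ hy n z • harmConj ℓ y₀ z

theorem contDiff_testMap (hℓ : 0 < ℓ) (hy : |y₀| < ℓ / 2) (n : ℕ) :
    ContDiff ℝ ∞ (testMap hℓ hy n) := by
  rw [contDiff_iff_contDiffAt]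
  intro z
  by_cases hz : z ∈ wideStrip ℓ y₀
  · exact (contDiff_cutoff hℓ hy n).contDiffAt.smul
      ((contDiffOn_harmConj hℓ).contDiffAt ((isOpen_wideStrip ℓ y₀).mem_nhds hz))
  · have h1 : z ∉ tsupport (cutoff hℓ hy n) := fun h => hz (tsupport_cutoff_subset hℓ hy n h)
    refine (contDiffAt_const (c := (0 : ℂ))).congr_of_eventuallyEq ?_
    filter_upwards [notMem_tsupport_iff_eventuallyEq.1 h1] with w hw
    simp [testMap, hw]

theorem hasCompactSupport_testMap (hℓ : 0 < ℓ) (hy : |y₀| < ℓ / 2) (n : ℕ) :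
    HasCompactSupport (testMap hℓ hy n) :=
  (hasCompactSupport_cutoff hℓ hy n).smul_right

theorem testMap_eq (hℓ : 0 < ℓ) (hy : |y₀| < ℓ / 2) (n : ℕ) {z : ℂ} (hz : z ∈ strip ℓ) :
    testMap hℓ hy n z = cutoffRe (z.re / (n + 1)) • harmConj ℓ y₀ z := by
  have : cutoffIm hℓ hy z.im = 1 := (cutoffIm hℓ hy).one_of_mem_closedBall (by
    rw [mem_closedBall_zero_iff]; exact (mem_strip.1 hz).le)
  rw [testMap, cutoff, this, mul_one]

theorem fderiv_testMap_I (hℓ : 0 < ℓ) (hy : |y₀| < ℓ / 2) (n : ℕ) {z : ℂ} (hz : z ∈ strip ℓ) :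
    fderiv ℝ (testMap hℓ hy n) z Complex.I =
      cutoffRe (z.re / (n + 1)) • extremalX ℓ y₀ z := by
  have h1 := ((contDiff_testMap hℓ hy n).differentiable (by simp) z).hasFDerivAt.comp_hasDerivAt
    z.im (hasDerivAt_mk_im z)
  refine h1.unique (((hasDerivAt_harmConj_im hℓ hy hz).const_smul
    (cutoffRe (z.re / (n + 1)))).congr_of_eventuallyEq ?_)
  filter_upwards [(hasDerivAt_mk_im z).continuousAt.preimage_mem_nhds
    ((isOpen_strip ℓ).mem_nhds hz)] with s hs
  exact testMap_eq hℓ hy n hs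

theorem fderiv_testMap_one (hℓ : 0 < ℓ) (hy : |y₀| < ℓ / 2) (n : ℕ) {z : ℂ} (hz : z ∈ strip ℓ) :
    fderiv ℝ (testMap hℓ hy n) z 1 =
      cutoffRe (z.re / (n + 1)) • (-extremalY ℓ y₀ z)
        + (deriv cutoffRe (z.re / (n + 1)) / (n + 1)) • harmConj ℓ y₀ z := by
  have h1 := ((contDiff_testMap hℓ hy n).differentiable (by simp) z).hasFDerivAt.comp_hasDerivAt
    z.re (hasDerivAt_mk_re z)
  have h2 : HasDerivAt (fun x : ℝ => cutoffRe (x / (n + 1)))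
      (deriv cutoffRe (z.re / (n + 1)) / (n + 1)) z.re := by
    have h3 := (cutoffRe.contDiff (n := 1)).differentiable (by simp) (z.re / (n + 1))
    refine (h3.hasDerivAt.comp z.re ((hasDerivAt_id z.re).div_const ((n : ℝ) + 1))).congr_deriv ?_
    ring
  refine h1.unique ((h2.smul (hasDerivAt_harmConj_re hℓ hy hz)).congr_of_eventuallyEq ?_)
  filter_upwards [(hasDerivAt_mk_re z).continuousAt.preimage_mem_nhds
    ((isOpen_strip ℓ).mem_nhds hz)] with s hs
  exact testMap_eq hℓ hy n hs

/-- On the support of the derivative of the rescaled cutoff, `n + 1` is comparable to `|x|`, which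
gives a bound independent of `n`. -/
theorem exists_bound_deriv_cutoffRe : ∃ M, 0 ≤ M ∧ (∀ x, |deriv cutoffRe x| ≤ M) ∧
    ∀ (n : ℕ) (x : ℝ), |deriv cutoffRe (x / (n + 1)) / (n + 1)| ≤ 3 * M / (1 + |x|) := by
  have hcont : Continuous (deriv cutoffRe) :=
    (cutoffRe.contDiff (n := 1)).continuous_deriv (by simp)
  obtain ⟨M, hM⟩ := hcont.bounded_above_of_compact_support cutoffRe.hasCompactSupport.deriv
  have hM0 : 0 ≤ M := (norm_nonneg _).trans (hM 0)
  refine ⟨M, hM0, hM, fun n x => ?_⟩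
  have hn : (1 : ℝ) ≤ n + 1 := by linarith [(Nat.cast_nonneg n : (0 : ℝ) ≤ n)]
  by_cases h : x / (n + 1) ∈ tsupport (deriv cutoffRe)
  · have h1 : x / (n + 1) ∈ Metric.closedBall (0 : ℝ) 2 := by
      have := (tsupport_deriv_subset (𝕜 := ℝ) (f := cutoffRe)) h
      rwa [ContDiffBump.tsupport_eq] at this
    rw [mem_closedBall_zero_iff, Real.norm_eq_abs, abs_div,
      abs_of_pos (by linarith : (0:ℝ) < n + 1), div_le_iff₀ (by linarith)] at h1
    rw [abs_div, abs_of_pos (by linarith : (0:ℝ) < n + 1), div_le_div_iff₀ (by linarith)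
      (by positivity)]
    calc |deriv cutoffRe (x / (n + 1))| * (1 + |x|) ≤ M * (3 * (n + 1)) := by
          gcongr
          · exact hM _
          · linarith
      _ = _ := by ring
  · rw [image_eq_zero_of_notMem_tsupport h]
    simp; positivity

/-- The function `1 / (1 + |x|)` on the strip. -/
def stripWeight (ℓ : ℝ) (z : ℂ) : ℝ := (1 + |z.re|)⁻¹ * (Ioo (-(ℓ / 2)) (ℓ / 2)).indicator 1 z.im

theorem measurable_stripWeight (ℓ : ℝ) : Measurable (stripWeight ℓ) :=
  (by fun_prop : Measurable fun z : ℂ => (1 + |z.re|)⁻¹).mul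
    ((measurable_one.indicator measurableSet_Ioo).comp Complex.measurable_im)

theorem memLp_stripWeight (ℓ : ℝ) : MemLp (stripWeight ℓ) 2 := by
  rw [memLp_two_iff_integrable_sq (measurable_stripWeight ℓ).aestronglyMeasurable]
  have h1 : Integrable (fun x : ℝ => ((1 + |x|)⁻¹) ^ 2) := by
    have := integrable_one_add_norm (E := ℝ) (μ := volume) (r := 2) (by simp)
    refine this.congr (Eventually.of_forall fun x => ?_)
    have hp : 0 < 1 + ‖x‖ := by positivity
    simp only
    rw [Real.rpow_neg hp.le, Real.rpow_two, inv_pow]; rfl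
  have h2 : Integrable (fun y : ℝ => ((Ioo (-(ℓ / 2)) (ℓ / 2)).indicator (1 : ℝ → ℝ) y) ^ 2) := by
    have h3 : (fun y : ℝ => ((Ioo (-(ℓ / 2)) (ℓ / 2)).indicator (1 : ℝ → ℝ) y) ^ 2) =
        (Ioo (-(ℓ / 2)) (ℓ / 2)).indicator (fun _ => (1 : ℝ)) := by
      ext y; by_cases h : y ∈ Ioo (-(ℓ / 2)) (ℓ / 2) <;> simp [h]
    rw [h3, integrable_indicator_iff measurableSet_Ioo]
    exact integrableOn_const (by simp)
  have h3 := (Complex.volume_preserving_equiv_real_prod.integrable_comp_emb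
    (MeasurableEquiv.measurableEmbedding _)).2 (h1.mul_prod h2)
  refine h3.congr (Eventually.of_forall fun z => ?_)
  simp [stripWeight, mul_pow, Complex.measurableEquivRealProd_apply]

theorem stripWeight_of_mem {z : ℂ} (hz : z ∈ strip ℓ) : stripWeight ℓ z = (1 + |z.re|)⁻¹ := by
  have h : z.im ∈ Ioo (-(ℓ / 2)) (ℓ / 2) := hz
  simp [stripWeight, h]

/-- The gradient of the extremal map is orthogonal to the gradient of every finite energy
variation supported in the strip. The test function is a cutoff times the harmonic conjugate:
the only error term is the product of the derivative of the cutoff, the bounded conjugate and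
one partial derivative of the variation, so no Poincaré inequality is needed. -/
theorem integral_extremal_inner_eq_zero (hℓ : 0 < ℓ) (hy : |y₀| < ℓ / 2) {w wx wy : ℂ → ℂ}
    (hw : HasWeakGradient w wx wy) (h0 : ∀ᵐ z : ℂ, z ∉ strip ℓ → w z = 0)
    (hx : MemLp wx 2) (hyy : MemLp wy 2) :
    ∫ z, (conj (extremalX ℓ y₀ z) * wx z + conj (extremalY ℓ y₀ z) * wy z) = 0 := by
  obtain ⟨hx0, hy0⟩ := hw.ae_eq_zero_off_strip h0
  obtain ⟨D, hD⟩ := exists_bound_harmConj hℓ hy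
  obtain ⟨M, hM0, hM, hM'⟩ := exists_bound_deriv_cutoffRe
  have mconj : Measurable (conj : ℂ → ℂ) := Complex.continuous_conj.measurable
  have iX : Integrable (fun z => conj (extremalX ℓ y₀ z) * wx z) :=
    ((decays_extremalX hℓ hy).conj.memLp_two
      (mconj.comp (measurable_extremalX hℓ hy))).integrable_mul hx
  have iY : Integrable (fun z => conj (extremalY ℓ y₀ z) * wy z) :=
    ((decays_extremalY hℓ hy).conj.memLp_two
      (mconj.comp (measurable_extremalY hℓ hy))).integrable_mul hyy
  set κ : ℕ → ℂ → ℝ := fun n z => cutoffRe (z.re / (n + 1)) with hκ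
  have mκ : ∀ n, Continuous (κ n) := fun n =>
    cutoffRe.continuous.comp (Complex.continuous_re.div_const _)
  have bκ : ∀ n z, ‖κ n z‖ ≤ 1 := fun n z => by
    rw [Real.norm_of_nonneg cutoffRe.nonneg]; exact cutoffRe.le_one
  have iκ : ∀ (n : ℕ) {g : ℂ → ℂ}, Integrable g → Integrable (fun z => κ n z • g z) :=
    fun n g hg => hg.bdd_smul 1 (mκ n).aestronglyMeasurable (Eventually.of_forall (bκ n))
  set E : ℕ → ℂ → ℂ := fun n z =>
    (deriv cutoffRe (z.re / (n + 1)) / (n + 1)) • (conj (harmConj ℓ y₀ z) * wy z) with hE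
  have i2 : ∀ n, Integrable (fun z => conj (fderiv ℝ (testMap hℓ hy n) z 1) * wy z) := by
    intro n
    refine hw.gy_l2.locallyIntegrable.integrable_smul_left_of_hasCompactSupport
      (𝕜 := ℂ) ?_ ?_
    · exact Complex.continuous_conj.comp
        (((contDiff_testMap hℓ hy n).continuous_fderiv (by simp)).clm_apply continuous_const)
    · exact ((hasCompactSupport_testMap hℓ hy n).fderiv_apply (𝕜 := ℝ) 1).comp_left
        (g := conj) (map_zero _)
  have hEae : ∀ n, E n =ᵐ[volume] fun z => conj (fderiv ℝ (testMap hℓ hy n) z 1) * wy z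
      + κ n z • (conj (extremalY ℓ y₀ z) * wy z) := by
    intro n
    filter_upwards [hy0] with z hz
    by_cases hzs : z ∈ strip ℓ
    · simp only [fderiv_testMap_one hℓ hy n hzs, hκ, hE, Complex.real_smul, map_mul, map_add,
        map_neg, Complex.conj_ofReal]
      ring
    · simp [hz hzs, hE]
  have key : ∀ n, ∫ z, κ n z • (conj (extremalX ℓ y₀ z) * wx z + conj (extremalY ℓ y₀ z) * wy z) =
      ∫ z, E n z := by
    intro n
    have h := hw.integral_conj_fderiv_mul_comm (contDiff_testMap hℓ hy n)
      (hasCompactSupport_testMap hℓ hy n)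
    have e1 : ∫ z, conj (fderiv ℝ (testMap hℓ hy n) z Complex.I) * wx z =
        ∫ z, κ n z • (conj (extremalX ℓ y₀ z) * wx z) := by
      refine integral_congr_ae ?_
      filter_upwards [hx0] with z hz
      by_cases hzs : z ∈ strip ℓ
      · simp only [fderiv_testMap_I hℓ hy n hzs, hκ, Complex.real_smul, map_mul,
          Complex.conj_ofReal]
        ring
      · simp [hz hzs]
    simp only [smul_add]
    rw [integral_congr_ae (hEae n), integral_add (iκ n iX) (iκ n iY),
      integral_add (i2 n) (iκ n iY), ← e1, h]
  have lim1 : Tendsto (fun n => ∫ z, κ n z • (conj (extremalX ℓ y₀ z) * wx z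
      + conj (extremalY ℓ y₀ z) * wy z)) atTop
      (𝓝 (∫ z, (conj (extremalX ℓ y₀ z) * wx z + conj (extremalY ℓ y₀ z) * wy z))) := by
    have i3 : Integrable (fun z => conj (extremalX ℓ y₀ z) * wx z
      + conj (extremalY ℓ y₀ z) * wy z) := iX.add iY
    refine tendsto_integral_of_dominated_convergence _ (fun n => (iκ n i3).aestronglyMeasurable)
      i3.norm (fun n => Eventually.of_forall fun z => ?_) (Eventually.of_forall fun z => ?_)
    · rw [norm_smul]
      exact mul_le_of_le_one_left (norm_nonneg _) (bκ n z)
    · have h1 : Tendsto (fun n : ℕ => z.re / ((n : ℝ) + 1)) atTop (𝓝 0) :=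
        tendsto_const_nhds.div_atTop
          (tendsto_atTop_add_const_right _ 1 tendsto_natCast_atTop_atTop)
      have h2 : Tendsto (fun n : ℕ => κ n z) atTop (𝓝 1) := by
        have := (cutoffRe.continuous.tendsto 0).comp h1
        rwa [cutoffRe.one_of_mem_closedBall (Metric.mem_closedBall_self zero_le_one)] at this
      simpa using h2.smul_const (conj (extremalX ℓ y₀ z) * wx z + conj (extremalY ℓ y₀ z) * wy z)
  have lim2 : Tendsto (fun n => ∫ z, E n z) atTop (𝓝 0) := by
    have hbd : Integrable (fun z => (3 * M * D) * (stripWeight ℓ z * ‖wy z‖)) :=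
      ((memLp_stripWeight ℓ).integrable_mul hyy.norm).const_mul _
    have hlim : Tendsto (fun n => ∫ z, E n z) atTop (𝓝 (∫ _ : ℂ, (0 : ℂ))) := by
      refine tendsto_integral_of_dominated_convergence _ (fun n => ?_) hbd (fun n => ?_)
        (Eventually.of_forall fun z => ?_)
      · exact ((i2 n).add (iκ n iY)).aestronglyMeasurable.congr (hEae n).symm
      · filter_upwards [hy0] with z hz
        by_cases hzs : z ∈ strip ℓ
        · rw [hE]
          simp only [norm_smul, norm_mul, RCLike.norm_conj]
          rw [stripWeight_of_mem hzs]
          calc _ ≤ 3 * M / (1 + |z.re|) * (D * ‖wy z‖) := by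
                gcongr
                · exact hM' n z.re
                · exact hD z hzs
            _ = _ := by ring
        · simp [hz hzs, hE]
      · have h1 : Tendsto (fun n : ℕ => deriv cutoffRe (z.re / ((n : ℝ) + 1)) / ((n : ℝ) + 1))
            atTop (𝓝 0) := by
          have h2 : Tendsto (fun n : ℕ => M / ((n : ℝ) + 1)) atTop (𝓝 0) :=
            tendsto_const_nhds.div_atTop
              (tendsto_atTop_add_const_right _ 1 tendsto_natCast_atTop_atTop)
          refine squeeze_zero_norm (fun n => ?_) h2
          rw [norm_div, Real.norm_of_nonneg (by positivity : (0 : ℝ) ≤ (n : ℝ) + 1)]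
          gcongr
          exact hM _
        have h3 := h1.smul_const (conj (harmConj ℓ y₀ z) * wy z)
        rwa [zero_smul] at h3
    simpa using hlim
  simp only [key] at lim1
  exact tendsto_nhds_unique lim1 lim2

end

/-! ### The energy of the extremal map -/

section

variable {ℓ y₀ : ℝ}

theorem enorm_sq_eq_ofReal (a : ℂ) : ‖a‖ₑ ^ 2 = ENNReal.ofReal (‖a‖ ^ 2) := by
  rw [ENNReal.ofReal_pow (norm_nonneg _), ofReal_norm]

theorem memLp_two_of_lintegral_ne_top {g : ℂ → ℂ} (hm : AEStronglyMeasurable g)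
    (h : ∫⁻ z, ‖g z‖ₑ ^ 2 ≠ ⊤) : MemLp g 2 := by
  rw [memLp_two_iff_integrable_sq_norm hm]
  refine ⟨(hm.norm.pow 2), ?_⟩
  rw [hasFiniteIntegral_iff_ofReal (Eventually.of_forall fun z => by positivity)]
  simp only [← enorm_sq_eq_ofReal]
  exact h.lt_top

theorem lintegral_grad_eq_ofReal {a b : ℂ → ℂ} (ha : MemLp a 2) (hb : MemLp b 2) :
    ∫⁻ z, (‖a z‖ₑ ^ 2 + ‖b z‖ₑ ^ 2) =
      ENNReal.ofReal ((∫ z, ‖a z‖ ^ 2) + ∫ z, ‖b z‖ ^ 2) := by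
  have ia := (memLp_two_iff_integrable_sq_norm ha.1).1 ha
  have ib := (memLp_two_iff_integrable_sq_norm hb.1).1 hb
  rw [← integral_add ia ib, ofReal_integral_eq_lintegral_ofReal
    (f := fun z => ‖a z‖ ^ 2 + ‖b z‖ ^ 2) (ia.add ib)
    (Eventually.of_forall fun z => by positivity)]
  congr 1 with z
  rw [ENNReal.ofReal_add (by positivity) (by positivity), enorm_sq_eq_ofReal, enorm_sq_eq_ofReal]

theorem integral_norm_sq_dHol_eq (hℓ : 0 < ℓ) (hy : |y₀| < ℓ / 2) :
    ∫ z, ‖dHol ℓ y₀ z‖ ^ 2 = ∫ z, ‖dAnti ℓ y₀ z‖ ^ 2 := by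
  have h := integral_sq_dHol_eq hℓ hy
  simp only [Complex.conj_mul', ← Complex.ofReal_pow, integral_complex_ofReal] at h
  exact_mod_cast h

/-- The energy of the extremal map is four times the area of the disc onto which the tanh term
maps the strip. -/
theorem lintegral_grad_extremal (hℓ : 0 < ℓ) (hy : |y₀| < ℓ / 2) :
    ∫⁻ z, (‖extremalX ℓ y₀ z‖ₑ ^ 2 + ‖extremalY ℓ y₀ z‖ₑ ^ 2) =
      ENNReal.ofReal (4 * Real.pi ^ 3 / (ℓ ^ 2 * Real.cos (Real.pi * y₀ / ℓ) ^ 2)) := by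
  have hA := (decays_dHol hℓ hy).memLp_two (measurable_dHol hℓ hy)
  have hB := (decays_dAnti hℓ hy).memLp_two (measurable_dAnti hℓ hy)
  have e1 : ∀ z, ‖extremalX ℓ y₀ z‖ₑ ^ 2 + ‖extremalY ℓ y₀ z‖ₑ ^ 2 =
      ENNReal.ofReal 2 * (‖dHol ℓ y₀ z‖ₑ ^ 2 + ‖dAnti ℓ y₀ z‖ₑ ^ 2) := by
    intro z
    simp only [enorm_sq_eq_ofReal]
    rw [← ENNReal.ofReal_add (by positivity) (by positivity),
      ← ENNReal.ofReal_add (by positivity) (by positivity), ← ENNReal.ofReal_mul (by norm_num)]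
    congr 1
    rw [extremalX, extremalY, norm_mul, Complex.norm_I, one_mul]
    simp only [Complex.sq_norm, Complex.normSq_apply, Complex.add_re, Complex.add_im,
      Complex.sub_re, Complex.sub_im]
    ring
  have iA := (memLp_two_iff_integrable_sq_norm hA.1).1 hA
  have e2 : ENNReal.ofReal (∫ z, ‖dHol ℓ y₀ z‖ ^ 2) =
      ENNReal.ofReal (Real.pi ^ 3 / (ℓ ^ 2 * Real.cos (Real.pi * y₀ / ℓ) ^ 2)) := by
    rw [ofReal_integral_eq_lintegral_ofReal iA (Eventually.of_forall fun z => by positivity),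
      ← lintegral_sq_hol₁ hℓ hy, ← lintegral_indicator (isOpen_strip ℓ).measurableSet]
    congr 1 with z
    by_cases hz : z ∈ strip ℓ
    · rw [indicator_of_mem hz, dHol, glue_of_mem hz]
    · rw [indicator_of_notMem hz, dHol, glue_of_notMem hz]; simp
  simp only [e1]
  rw [lintegral_const_mul' _ _ (by simp), lintegral_grad_eq_ofReal hA hB,
    ← integral_norm_sq_dHol_eq hℓ hy, ← two_mul, ENNReal.ofReal_mul (by norm_num), e2,
    ← ENNReal.ofReal_mul (by norm_num), ← ENNReal.ofReal_mul (by norm_num)]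
  congr 1
  ring

/-- Pythagoras for the Dirichlet energy: a competitor exceeds the extremal map by the energy of
the difference. -/
theorem lintegral_grad_competitor (hℓ : 0 < ℓ) (hy : |y₀| < ℓ / 2) {v gx gy : ℂ → ℂ}
    (hv : HasWeakGradient v gx gy) (h0 : ∀ᵐ z : ℂ, z ∉ strip ℓ → v z = extremal ℓ y₀ z)
    (hfin : ∫⁻ z, (‖gx z‖ₑ ^ 2 + ‖gy z‖ₑ ^ 2) ≠ ⊤) :
    ∫⁻ z, (‖gx z‖ₑ ^ 2 + ‖gy z‖ₑ ^ 2) =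
      (∫⁻ z, (‖extremalX ℓ y₀ z‖ₑ ^ 2 + ‖extremalY ℓ y₀ z‖ₑ ^ 2)) +
      ∫⁻ z, (‖gx z - extremalX ℓ y₀ z‖ₑ ^ 2 + ‖gy z - extremalY ℓ y₀ z‖ₑ ^ 2) := by
  have mgx := memLp_two_of_lintegral_ne_top hv.gx_l2.locallyIntegrable.aestronglyMeasurable
    (ne_top_of_le_ne_top hfin (lintegral_mono fun z => le_self_add))
  have mgy := memLp_two_of_lintegral_ne_top hv.gy_l2.locallyIntegrable.aestronglyMeasurable
    (ne_top_of_le_ne_top hfin (lintegral_mono fun z => le_add_self))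
  have mX := (decays_extremalX hℓ hy).memLp_two (measurable_extremalX hℓ hy)
  have mY := (decays_extremalY hℓ hy).memLp_two (measurable_extremalY hℓ hy)
  have mconj : Measurable (conj : ℂ → ℂ) := Complex.continuous_conj.measurable
  have mX' := (decays_extremalX hℓ hy).conj.memLp_two (mconj.comp (measurable_extremalX hℓ hy))
  have mY' := (decays_extremalY hℓ hy).conj.memLp_two (mconj.comp (measurable_extremalY hℓ hy))
  have mwx : MemLp (fun z => gx z - extremalX ℓ y₀ z) 2 := mgx.sub mX
  have mwy : MemLp (fun z => gy z - extremalY ℓ y₀ z) 2 := mgy.sub mY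
  have orth := integral_extremal_inner_eq_zero hℓ hy (hv.sub (hasWeakGradient_extremal hℓ hy))
    (h0.mono fun z hz hzs => sub_eq_zero.2 (hz hzs)) mwx mwy
  have sqi : ∀ {g : ℂ → ℂ}, MemLp g 2 → Integrable (fun z => ‖g z‖ ^ 2) :=
    fun hg => (memLp_two_iff_integrable_sq_norm hg.1).1 hg
  have iX : Integrable (fun z => conj (extremalX ℓ y₀ z) * (gx z - extremalX ℓ y₀ z)) :=
    mX'.integrable_mul mwx
  have iY : Integrable (fun z => conj (extremalY ℓ y₀ z) * (gy z - extremalY ℓ y₀ z)) :=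
    mY'.integrable_mul mwy
  have expand : ∀ a b : ℂ, ‖b‖ ^ 2 = ‖a‖ ^ 2 + ‖b - a‖ ^ 2 + 2 * (conj a * (b - a)).re := by
    intro a b
    simp only [Complex.sq_norm, Complex.normSq_apply, Complex.sub_re, Complex.sub_im,
      Complex.mul_re, Complex.conj_re, Complex.conj_im]
    ring
  have exp_int : ∀ {a b : ℂ → ℂ}, MemLp a 2 → MemLp (fun z => b z - a z) 2 →
      Integrable (fun z => conj (a z) * (b z - a z)) → ∫ z, ‖b z‖ ^ 2 =
      (∫ z, ‖a z‖ ^ 2) + (∫ z, ‖b z - a z‖ ^ 2) + 2 * (∫ z, conj (a z) * (b z - a z)).re := by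
    intro a b ha hba hab
    have hre : (∫ z, conj (a z) * (b z - a z)).re = ∫ z, (conj (a z) * (b z - a z)).re :=
      (Complex.reCLM.integral_comp_comm hab).symm
    have i1 : Integrable (fun z => ‖a z‖ ^ 2 + ‖b z - a z‖ ^ 2) := (sqi ha).add (sqi hba)
    have i2 : Integrable (fun z => 2 * (conj (a z) * (b z - a z)).re) := hab.re.const_mul 2
    rw [hre, ← integral_add (sqi ha) (sqi hba), ← integral_const_mul, ← integral_add i1 i2]
    exact integral_congr_ae (Eventually.of_forall fun z => expand (a z) (b z))
  rw [lintegral_grad_eq_ofReal mgx mgy, lintegral_grad_eq_ofReal mX mY,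
    lintegral_grad_eq_ofReal mwx mwy, ← ENNReal.ofReal_add (by positivity) (by positivity)]
  congr 1
  rw [integral_add iX iY] at orth
  have orth' := congrArg Complex.re orth
  rw [Complex.add_re, Complex.zero_re] at orth'
  rw [exp_int mX mwx iX, exp_int mY mwy iY]
  linear_combination 2 * orth'

/-! ### The minimization problem -/

theorem stripMap_eq_extremal (hℓ : 0 < ℓ) (hy : |y₀| < ℓ / 2) :
    stripMap ℓ y₀ = extremal ℓ y₀ := by
  ext z
  have hr : (Real.pi / ℓ : ℂ) = 2 * rate ℓ := by
    rw [rate]; push_cast; field_simp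
  have hr' : (Real.pi / (2 * ℓ) : ℂ) = rate ℓ := by rw [rate]; push_cast; rfl
  have hc : (rate ℓ : ℂ) ≠ 0 := by exact_mod_cast (rate_pos hℓ).ne'
  by_cases hz : z ∈ strip ℓ
  · rw [stripMap, if_pos hz, extremal, glue_of_mem hz, hr, hr', hol, anti]
    rcases eq_or_ne (conj z + Complex.I * y₀) 0 with hw | hw
      -- At the singularity the quotients in `coth` and the tail are `x / 0 = 0`, as is `cothReg 0`.
    · have e : arg ℓ y₀ (conj z) = 0 := by rw [arg, hw, mul_zero]
      rw [e, cothReg_zero, hw]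
      simp [coth, arg]
    · have hq0 : arg ℓ y₀ (conj z) ≠ 0 := mul_ne_zero hc hw
      rw [cothReg_of_ne_zero hq0 (arg_mem_cothDomain hℓ
        (conj_mem_wideStrip (strip_subset_wideStrip hy hz)))]
      simp only [coth, arg]
      field_simp
      ring
  · rw [stripMap, if_neg hz, extremal, glue_of_notMem hz, tail]

theorem tail_eq (z : ℂ) : 2 / (conj z - conj (Complex.I * (y₀ : ℂ))) = tail y₀ (conj z) := by
  simp [tail]

theorem extremal_mem_tailCompetitors (hℓ : 0 < ℓ) (hy : |y₀| < ℓ / 2) :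
    extremal ℓ y₀ ∈ tailCompetitors (strip ℓ) (Complex.I * (y₀ : ℂ)) :=
  ⟨⟨_, _, hasWeakGradient_extremal hℓ hy⟩, Eventually.of_forall fun z hz => by
    rw [tail_eq, extremal, glue_of_notMem hz]⟩

theorem eq_extremal_of_mem_tailCompetitors {v : ℂ → ℂ}
    (hv : v ∈ tailCompetitors (strip ℓ) (Complex.I * (y₀ : ℂ))) :
    ∀ᵐ z : ℂ, z ∉ strip ℓ → v z = extremal ℓ y₀ z :=
  hv.2.mono fun z h hz => by rw [h hz, tail_eq, extremal, glue_of_notMem hz]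

theorem le_dirichletEnergy (hℓ : 0 < ℓ) (hy : |y₀| < ℓ / 2) {v : ℂ → ℂ}
    (hv : v ∈ tailCompetitors (strip ℓ) (Complex.I * (y₀ : ℂ))) :
    ∫⁻ z, (‖extremalX ℓ y₀ z‖ₑ ^ 2 + ‖extremalY ℓ y₀ z‖ₑ ^ 2) ≤ dirichletEnergy v := by
  refine le_iInf fun gx => le_iInf fun gy => le_iInf fun hg => ?_
  by_cases hfin : ∫⁻ z, (‖gx z‖ₑ ^ 2 + ‖gy z‖ₑ ^ 2) = ⊤
  · rw [hfin]; exact le_top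
  · rw [lintegral_grad_competitor hℓ hy hg (eq_extremal_of_mem_tailCompetitors hv) hfin]
    exact le_self_add

/-- The weak gradient is unique almost everywhere, so any of its versions computes the energy. -/
theorem HasWeakGradient.dirichletEnergy_eq {v gx gy : ℂ → ℂ} (hg : HasWeakGradient v gx gy) :
    dirichletEnergy v = ∫⁻ z, (‖gx z‖ₑ ^ 2 + ‖gy z‖ₑ ^ 2) := by
  refine le_antisymm (iInf_le_of_le gx (iInf_le_of_le gy (iInf_le _ hg)))
    (le_iInf fun hx => le_iInf fun hy => le_iInf fun hh => le_of_eq ?_)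
  obtain ⟨h1, h2⟩ := hg.ae_eq hh
  refine lintegral_congr_ae ?_
  filter_upwards [h1, h2] with z e1 e2
  rw [e1, e2]

theorem tailEnergy_strip (hℓ : 0 < ℓ) (hy : |y₀| < ℓ / 2) :
    tailEnergy (strip ℓ) (Complex.I * (y₀ : ℂ)) =
      ∫⁻ z, (‖extremalX ℓ y₀ z‖ₑ ^ 2 + ‖extremalY ℓ y₀ z‖ₑ ^ 2) := by
  refine le_antisymm ?_ (le_iInf₂ fun v hv => le_dirichletEnergy hℓ hy hv)
  rw [← (hasWeakGradient_extremal hℓ hy).dirichletEnergy_eq]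
  exact iInf₂_le _ (extremal_mem_tailCompetitors hℓ hy)

theorem tailEnergy_strip_eq (hℓ : 0 < ℓ) (hy : |y₀| < ℓ / 2) :
    tailEnergy (strip ℓ) (Complex.I * (y₀ : ℂ)) =
      ENNReal.ofReal (4 * Real.pi ^ 3 / (ℓ ^ 2 * Real.cos (Real.pi * y₀ / ℓ) ^ 2)) := by
  rw [tailEnergy_strip hℓ hy, lintegral_grad_extremal hℓ hy]

theorem isTailMinimizer_stripMap (hℓ : 0 < ℓ) (hy : |y₀| < ℓ / 2) :
    IsTailMinimizer (strip ℓ) (Complex.I * (y₀ : ℂ)) (stripMap ℓ y₀) := by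
  rw [stripMap_eq_extremal hℓ hy]
  refine ⟨extremal_mem_tailCompetitors hℓ hy, ?_, fun v hv he => ?_⟩
  · rw [tailEnergy_strip hℓ hy, (hasWeakGradient_extremal hℓ hy).dirichletEnergy_eq]
  · obtain ⟨gx, gy, hg⟩ := hv.1
    have h0 := eq_extremal_of_mem_tailCompetitors hv
    have hne : ∫⁻ z, (‖extremalX ℓ y₀ z‖ₑ ^ 2 + ‖extremalY ℓ y₀ z‖ₑ ^ 2) ≠ ⊤ := by
      rw [lintegral_grad_extremal hℓ hy]; exact ENNReal.ofReal_ne_top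
    rw [hg.dirichletEnergy_eq, tailEnergy_strip hℓ hy] at he
    have hp := lintegral_grad_competitor hℓ hy hg h0 (by rwa [he])
    rw [he] at hp
    have hz : ∫⁻ z, (‖gx z - extremalX ℓ y₀ z‖ₑ ^ 2 + ‖gy z - extremalY ℓ y₀ z‖ₑ ^ 2) = 0 := by
      exact (ENNReal.add_right_inj hne).1 (hp.symm.trans (add_zero _).symm)
    have hw := hg.sub (hasWeakGradient_extremal hℓ hy)
    have hwy := hw.gy_l2.locallyIntegrable.aestronglyMeasurable
    have hz' : ∫⁻ z, ‖gy z - extremalY ℓ y₀ z‖ₑ ^ 2 = 0 :=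
      le_antisymm ((lintegral_mono fun z => le_add_self).trans hz.le) zero_le
    rw [lintegral_eq_zero_iff' (hwy.enorm.pow_const 2)] at hz'
    have hgy : (fun z => gy z - extremalY ℓ y₀ z) =ᵐ[volume] 0 := by
      filter_upwards [hz'] with z h
      simpa using h
    have := hw.ae_eq_zero_of_grad_eq_zero hgy (M := ℓ / 2) (h0.mono fun z h him =>
      sub_eq_zero.2 (h fun hs => absurd hs.2 (not_lt.2 him)))
    filter_upwards [this] with z h
    exact sub_eq_zero.1 h

end

/-! ### The Dzyaloshinskii-Moriya term and the limit energy -/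

theorem fderiv_bpProfile_two (z v : ℂ) : fderiv ℝ (fun w => bpProfile w 2) z v =
    -4 * (z.re * v.re + z.im * v.im) / (1 + ‖z‖ ^ 2) ^ 2 := by
  have hp : (1 + ‖z‖ ^ 2) ≠ 0 := by positivity
  have h1 : HasDerivAt (fun s : ℝ => (1 - s) / (1 + s)) (-2 / (1 + ‖z‖ ^ 2) ^ 2) (‖z‖ ^ 2) := by
    refine (((hasDerivAt_id (‖z‖ ^ 2)).const_sub 1).div ((hasDerivAt_id (‖z‖ ^ 2)).const_add 1)
      hp).congr_deriv ?_
    simp only [id]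
    ring
  have h2 := h1.comp_hasFDerivAt z (hasStrictFDerivAt_norm_sq z).hasFDerivAt
  have h3 := congrArg (fun L : ℂ →L[ℝ] ℝ => L v) h2.fderiv
  refine Eq.trans h3 ?_
  simp [Complex.inner]
  field_simp
  ring

/-- In polar coordinates the primitive is `-4 / (1 + r²) + 2 / (1 + r²)²`. -/
theorem integral_dmi_density :
    ∫ z : ℂ, 8 * ‖z‖ ^ 2 / (1 + ‖z‖ ^ 2) ^ 3 = 4 * Real.pi := by
  have hF : ∀ y : ℝ, HasDerivAt (fun y : ℝ => -4 / (1 + y ^ 2) + 2 / (1 + y ^ 2) ^ 2)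
      (y ^ (2 - 1) • (8 * y ^ 2 / (1 + y ^ 2) ^ 3)) y := by
    intro y
    have hp : (1 + y ^ 2) ≠ 0 := by positivity
    have h1 : HasDerivAt (fun y : ℝ => 1 + y ^ 2) (2 * y) y := by
      simpa using (hasDerivAt_pow 2 y).const_add 1
    refine (((hasDerivAt_const y (-4 : ℝ)).div h1 hp).add
      ((hasDerivAt_const y (2 : ℝ)).div (h1.pow 2) (pow_ne_zero 2 hp))).congr_deriv ?_
    simp
    field_simp
    ring
  have hlim : Tendsto (fun y : ℝ => -4 / (1 + y ^ 2) + 2 / (1 + y ^ 2) ^ 2) atTop (𝓝 0) := by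
    have h1 : Tendsto (fun y : ℝ => 1 + y ^ 2) atTop atTop :=
      tendsto_atTop_add_const_left _ 1 (tendsto_pow_atTop two_ne_zero)
    have h2 : Tendsto (fun y : ℝ => (1 + y ^ 2) ^ 2) atTop atTop :=
      (tendsto_pow_atTop two_ne_zero).comp h1
    simpa using! (tendsto_const_nhds (x := (-4 : ℝ))).div_atTop h1 |>.add
      ((tendsto_const_nhds (x := (2 : ℝ))).div_atTop h2)
  have hint := integral_Ioi_of_hasDerivAt_of_nonneg' (a := 0) (fun y _ => hF y)
    (fun y hy => by have : (0 : ℝ) < y := hy; simp only [smul_eq_mul]; positivity) hlim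
  have := integral_fun_norm_addHaar (volume : Measure ℂ)
    (fun r : ℝ => 8 * r ^ 2 / (1 + r ^ 2) ^ 3)
  rw [this, Complex.finrank_real_complex, hint, measureReal_def, Complex.volume_ball]
  simp
  ring

theorem dmi_integrand (R : Matrix.specialOrthogonalGroup (Fin 3) ℝ)
    (h0 : R.1 0 2 = 0) (h1 : R.1 1 2 = 0) (z : ℂ) :
    (R.1 *ᵥ bpProfile z) 0 * fderiv ℝ (fun w => bpProfile w 2) z 1
      + (R.1 *ᵥ bpProfile z) 1 * fderiv ℝ (fun w => bpProfile w 2) z Complex.I =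
    8 * ((R.1 0 0 * z.re + R.1 0 1 * z.im) * z.re + (R.1 1 0 * z.re + R.1 1 1 * z.im) * z.im)
      / (1 + ‖z‖ ^ 2) ^ 3 := by
  have hp : (1 + ‖z‖ ^ 2) ≠ 0 := by positivity
  rw [fderiv_bpProfile_two, fderiv_bpProfile_two]
  simp only [Matrix.mulVec, dotProduct, Fin.sum_univ_three, h0, h1, bpProfile]
  simp
  field_simp
  ring

theorem dmiIntegral_one : dmiIntegral 1 = 4 * Real.pi := by
  rw [← integral_dmi_density, dmiIntegral]
  congr 1 with z
  rw [dmi_integrand 1 (by simp) (by simp), Complex.sq_norm, Complex.normSq_apply]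
  simp

/-- A rotation about the third axis can only decrease the Dzyaloshinskii-Moriya integral. -/
theorem dmiIntegral_le (R : Matrix.specialOrthogonalGroup (Fin 3) ℝ)
    (hR : R.1 *ᵥ ![0, 0, 1] = ![0, 0, 1]) : dmiIntegral R ≤ 4 * Real.pi := by
  have h0 : R.1 0 2 = 0 := by
    simpa [Matrix.mulVec, dotProduct, Fin.sum_univ_three] using congrFun hR 0
  have h1 : R.1 1 2 = 0 := by
    simpa [Matrix.mulVec, dotProduct, Fin.sum_univ_three] using congrFun hR 1
  have h2 : R.1 2 2 = 1 := by
    simpa [Matrix.mulVec, dotProduct, Fin.sum_univ_three] using congrFun hR 2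
  have hO : R.1ᵀ * R.1 = 1 := by
    have := (Matrix.mem_specialOrthogonalGroup_iff.1 R.2).1
    exact (Matrix.mem_orthogonalGroup_iff' (Fin 3) ℝ).1 this
  have e : ∀ i j, R.1 0 i * R.1 0 j + R.1 1 i * R.1 1 j + R.1 2 i * R.1 2 j =
      (1 : Matrix (Fin 3) (Fin 3) ℝ) i j := fun i j => by
    rw [← hO, Matrix.mul_apply, Fin.sum_univ_three]; rfl
  have e02 : R.1 2 0 = 0 := by simpa [h0, h1, h2] using e 0 2
  have e12 : R.1 2 1 = 0 := by simpa [h0, h1, h2] using e 1 2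
  have e00 := e 0 0
  have e11 := e 1 1
  have e01 := e 0 1
  simp [e02, e12] at e00 e11 e01
  have hform : ∀ x y : ℝ, |(R.1 0 0 * x + R.1 0 1 * y) * x + (R.1 1 0 * x + R.1 1 1 * y) * y| ≤
      x ^ 2 + y ^ 2 := by
    intro x y
    have hn : (R.1 0 0 * x + R.1 0 1 * y) ^ 2 + (R.1 1 0 * x + R.1 1 1 * y) ^ 2 =
        x ^ 2 + y ^ 2 := by
      linear_combination x ^ 2 * e00 + y ^ 2 * e11 + 2 * x * y * e01
    rw [abs_le]
    constructor
    · nlinarith [sq_nonneg (R.1 0 0 * x + R.1 0 1 * y + x),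
        sq_nonneg (R.1 1 0 * x + R.1 1 1 * y + y)]
    · nlinarith [sq_nonneg (R.1 0 0 * x + R.1 0 1 * y - x),
        sq_nonneg (R.1 1 0 * x + R.1 1 1 * y - y)]
  have hbound : ∀ z : ℂ, |8 * ((R.1 0 0 * z.re + R.1 0 1 * z.im) * z.re
      + (R.1 1 0 * z.re + R.1 1 1 * z.im) * z.im) / (1 + ‖z‖ ^ 2) ^ 3| ≤
      8 * ‖z‖ ^ 2 / (1 + ‖z‖ ^ 2) ^ 3 := by
    intro z
    have hz : z.re ^ 2 + z.im ^ 2 = ‖z‖ ^ 2 := by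
      rw [Complex.sq_norm, Complex.normSq_apply]; ring
    rw [abs_div, abs_mul, abs_of_pos (by positivity : 0 < (1 + ‖z‖ ^ 2) ^ 3),
      abs_of_pos (by norm_num : (0 : ℝ) < 8)]
    gcongr
    rw [← hz]
    exact hform _ _
  have hJ : Integrable (fun z : ℂ => 8 * ‖z‖ ^ 2 / (1 + ‖z‖ ^ 2) ^ 3) := by
    by_contra h
    have := integral_dmi_density
    rw [integral_undef h] at this
    linarith [Real.pi_pos]
  rw [← integral_dmi_density, dmiIntegral]
  simp only [dmi_integrand R h0 h1]
  refine integral_mono (hJ.mono' (Measurable.aestronglyMeasurable (by fun_prop))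
    (Eventually.of_forall hbound)) hJ fun z => (le_abs_self _).trans (hbound z)

end Skyrmion
end

theorem proposition2p7 (ℓ : ℝ) (hℓ : 0 < ℓ) :
    (∀ y₀ ∈ Set.Ioo (-(ℓ / 2)) (ℓ / 2),
      Skyrmion.IsTailMinimizer (Skyrmion.strip ℓ) (Complex.I * (y₀ : ℂ))
        (Skyrmion.stripMap ℓ y₀) ∧
      Skyrmion.tailEnergy (Skyrmion.strip ℓ) (Complex.I * (y₀ : ℂ)) =
        ENNReal.ofReal (4 * Real.pi ^ 3 / (ℓ ^ 2 * Real.cos (Real.pi * y₀ / ℓ) ^ 2))) ∧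
    IsMinOn (fun y₀ : ℝ => Skyrmion.tailEnergy (Skyrmion.strip ℓ) (Complex.I * (y₀ : ℂ)))
      (Set.Ioo (-(ℓ / 2)) (ℓ / 2)) 0 ∧
    Skyrmion.tailEnergy (Skyrmion.strip ℓ) 0 = ENNReal.ofReal (4 * Real.pi ^ 3 / ℓ ^ 2) ∧
    Skyrmion.skyrmionRadius (Skyrmion.strip ℓ) 0 = ℓ ^ 2 / Real.pi ^ 2 ∧
    (1, ℓ ^ 2 / Real.pi ^ 2, 0) ∈ Skyrmion.limitSet ℓ ∧
    IsMinOn (Skyrmion.limitEnergy ℓ) (Skyrmion.limitSet ℓ) (1, ℓ ^ 2 / Real.pi ^ 2, 0) ∧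
    Skyrmion.limitEnergy ℓ (1, ℓ ^ 2 / Real.pi ^ 2, 0) = -(4 * ℓ ^ 2 / Real.pi) := by
  have hpi := Real.pi_pos
  have hT : ∀ y₀ ∈ Set.Ioo (-(ℓ / 2)) (ℓ / 2),
      Skyrmion.tailEnergy (Skyrmion.strip ℓ) (Complex.I * (y₀ : ℂ)) =
        ENNReal.ofReal (4 * Real.pi ^ 3 / (ℓ ^ 2 * Real.cos (Real.pi * y₀ / ℓ) ^ 2)) :=
    fun y₀ hy => Skyrmion.tailEnergy_strip_eq hℓ (abs_lt.2 hy)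
  have hmem : (0 : ℝ) ∈ Set.Ioo (-(ℓ / 2)) (ℓ / 2) := ⟨by linarith, by linarith⟩
  have hT0 : Skyrmion.tailEnergy (Skyrmion.strip ℓ) 0 =
      ENNReal.ofReal (4 * Real.pi ^ 3 / ℓ ^ 2) := by
    simpa using hT 0 hmem
  have hle : ∀ y₀ ∈ Set.Ioo (-(ℓ / 2)) (ℓ / 2), 4 * Real.pi ^ 3 / ℓ ^ 2 ≤
      4 * Real.pi ^ 3 / (ℓ ^ 2 * Real.cos (Real.pi * y₀ / ℓ) ^ 2) := by
    intro y₀ hy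
    have hc : 0 < Real.cos (Real.pi * y₀ / ℓ) := by
      rw [← Skyrmion.two_rate_mul]
      exact Real.cos_pos_of_mem_Ioo (abs_lt.1 (Skyrmion.abs_two_rate_mul_lt hℓ (abs_lt.2 hy)))
    gcongr
    exact mul_le_of_le_one_right (by positivity) (Real.cos_sq_le_one _)
  have hE : Skyrmion.limitEnergy ℓ (1, ℓ ^ 2 / Real.pi ^ 2, 0) = -(4 * ℓ ^ 2 / Real.pi) := by
    simp only [Skyrmion.limitEnergy, Skyrmion.dmiIntegral_one, Complex.ofReal_zero, mul_zero, hT0]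
    rw [ENNReal.toReal_ofReal (by positivity)]
    field_simp
    ring
  refine ⟨fun y₀ hy => ⟨Skyrmion.isTailMinimizer_stripMap hℓ (abs_lt.2 hy),
    hT y₀ hy⟩, ?_, hT0, ?_, ?_, ?_, hE⟩
  · intro y₀ hy
    change Skyrmion.tailEnergy (Skyrmion.strip ℓ) (Complex.I * ((0 : ℝ) : ℂ)) ≤
      Skyrmion.tailEnergy (Skyrmion.strip ℓ) _
    rw [Complex.ofReal_zero, mul_zero, hT0, hT y₀ hy]
    exact ENNReal.ofReal_le_ofReal (hle y₀ hy)
  · rw [Skyrmion.skyrmionRadius, hT0, ENNReal.toReal_ofReal (by positivity)]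
    field_simp
  · exact ⟨by simp, by positivity, hmem⟩
  · rintro ⟨R, r, y⟩ ⟨hR, hr, hy⟩
    simp only at hR hr hy
    change Skyrmion.limitEnergy ℓ _ ≤ Skyrmion.limitEnergy ℓ (R, r, y)
    rw [hE]
    simp only [Skyrmion.limitEnergy, hT y hy]
    have hc := hle y hy
    have h0 : 0 ≤ 4 * Real.pi ^ 3 / ℓ ^ 2 := by positivity
    rw [ENNReal.toReal_ofReal (h0.trans hc)]
    calc -(4 * ℓ ^ 2 / Real.pi)
        ≤ r ^ 2 * (4 * Real.pi ^ 3 / ℓ ^ 2) - 2 * r * (4 * Real.pi) := by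
          -- Complete the square in `r`; the minimizer is `ℓ² / π²`.
          have e : r ^ 2 * (4 * Real.pi ^ 3 / ℓ ^ 2) - 2 * r * (4 * Real.pi)
              + 4 * ℓ ^ 2 / Real.pi = 4 / Real.pi * (r * Real.pi ^ 2 / ℓ - ℓ) ^ 2 := by
            field_simp
            ring
          have : 0 ≤ 4 / Real.pi * (r * Real.pi ^ 2 / ℓ - ℓ) ^ 2 := by positivity
          linarith
      _ ≤ _ := by
          have := Skyrmion.dmiIntegral_le R hR
          gcongr
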